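/- For a compact set $K\subset\mathbb{C}^k$ let $\hat K_{\mathcal P}=\{z\in\mathbb{C}^k : |p(z)|\le \sup_{\zeta\in K}|p(\zeta)| \text{ for every polynomial } p\}$. Let $U\subset\mathbb{C}^k$ be a polynomially convex domain, that is, $U$ is open and connected and $\hat K_{\mathcal P}\subset\subset U$ for every compact $K\subset U$. Let $f:U\to\mathbb{C}^k$ be holomorphic, let $\mathcal{C}\subset\subset U$ be a closed set with $f(\mathcal{C})\subset\mathcal{C}$, and suppose that $V=\mathrm{Int}(\hat{\mathcal{C}}_{\mathcal P})\neq\emptyset$. Then all iterates $f^n$ are defined on $V$ (that is, $f^n(V)\subset U$ for all $n\ge 0$), and $\{f^n\}_{n\in\mathbb{N}}$ is a normal family on $V$: every sequence of its members has a subsequence that converges locally uniformly on $V$. Moreover, let $W$ be a recurrent connected component of $V$, that is, one for which there are $p_0\in W$ and $n_1<n_2<\cdots$ such that $\{f^{n_i}(p_0)\}_i$ is relatively compact in $W$. Then at least one of the following holds: (i) $f$ has an attracting periodic orbit: there are $p\in U$ and $m\ge 1$ such that $f^i(p)\in U$ for all $i\ge 0$, $f^m(p)=p$, and all eigenvalues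 of the derivative of $f^m$ at $p$ have modulus less than $1$; (ii) there is a Siegel domain: a connected component $S$ of $V$ and $n_1<n_2<\cdots$ such that $f^{n_i}\to\mathrm{Id}$ locally uniformly on $S$; (iii) for $D=W$ and also for $D=V$: if $h$ is the locally uniform limit on $D$ of a subsequence of $\{f^n\}_{n\in\mathbb{N}}$, then $0<\mathrm{rank}\,h<k$, where $\mathrm{rank}\,h=\max_{z\in D}\mathrm{rank}\,Dh(z)$. -/

import Mathlib

open Set Filter

/-- `A ⊂⊂ B`: the closure of `A` is compact and contained in `B`. -/
def RelCompactIn {X : Type*} [TopologicalSpace X] (A B : Set X) : Prop :=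
  IsCompact (closure A) ∧ closure A ⊆ B

/-- The polynomially convex hull of a (compact) set `K ⊆ ℂ^k`. -/
def polyHull {k : ℕ} (K : Set (Fin k → ℂ)) : Set (Fin k → ℂ) :=
  {z | ∀ p : MvPolynomial (Fin k) ℂ,
    ‖MvPolynomial.eval z p‖ ≤ sSup ((fun ζ => ‖MvPolynomial.eval ζ p‖) '' K)}

/-- Polynomial convexity of an (open) set `U ⊆ ℂ^k`. -/
def IsPolyConvex {k : ℕ} (U : Set (Fin k → ℂ)) : Prop :=
  ∀ K : Set (Fin k → ℂ), IsCompact K → K ⊆ U → RelCompactIn (polyHull K) U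

/-- The family `{f^n}` is normal on the open set `V`: every sequence of its members has a
subsequence that converges locally uniformly on `V`. -/
def IteratesNormalOn {k : ℕ} (f : (Fin k → ℂ) → (Fin k → ℂ)) (V : Set (Fin k → ℂ)) : Prop :=
  ∀ u : ℕ → ℕ, ∃ φ : ℕ → ℕ, StrictMono φ ∧ ∃ h : (Fin k → ℂ) → (Fin k → ℂ),
    TendstoLocallyUniformlyOn (fun i => f^[u (φ i)]) h atTop V

/-- `h` is, on the open set `D`, the locally uniform limit of a subsequence of `{f^n}`. -/
def IsIterateLimitOn {k : ℕ} (f : (Fin k → ℂ) → (Fin k → ℂ)) (D : Set (Fin k → ℂ))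
    (h : (Fin k → ℂ) → (Fin k → ℂ)) : Prop :=
  ∃ n : ℕ → ℕ, StrictMono n ∧ TendstoLocallyUniformlyOn (fun i => f^[n i]) h atTop D

/-- `W` is a connected component of `V`. -/
def IsComponentOf {X : Type*} [TopologicalSpace X] (W V : Set X) : Prop :=
  ∃ x ∈ V, W = connectedComponentIn V x

/-- `W` is recurrent: for some `p₀ ∈ W` and some subsequence `n_i`, the set of all
`f^{n_i}(p₀)` is relatively compact in `W`. -/
def IsRecurrentFor {k : ℕ} (f : (Fin k → ℂ) → (Fin k → ℂ)) (W : Set (Fin k → ℂ)) : Prop :=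
  ∃ p₀ ∈ W, ∃ n : ℕ → ℕ, StrictMono n ∧ RelCompactIn (range fun i => f^[n i] p₀) W

/-- `f : U → ℂ^k` has an attracting periodic orbit: a periodic point whose orbit lies in `U` and
at which all eigenvalues of the derivative of the return map have modulus less than one. -/
def HasAttractingPeriodicOrbit {k : ℕ} (f : (Fin k → ℂ) → (Fin k → ℂ))
    (U : Set (Fin k → ℂ)) : Prop :=
  ∃ (p : Fin k → ℂ) (m : ℕ), 0 < m ∧ (∀ i, f^[i] p ∈ U) ∧ f^[m] p = p ∧
    ∀ μ : ℂ, Module.End.HasEigenvalue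
      ((fderiv ℂ (f^[m]) p : (Fin k → ℂ) →L[ℂ] (Fin k → ℂ)) : (Fin k → ℂ) →ₗ[ℂ] (Fin k → ℂ)) μ →
      ‖μ‖ < 1

/-- The rank on `D` of a map holomorphic on the open set `D`: the maximal rank of its complex
derivative at the points of `D`. -/
noncomputable def mapRank {k : ℕ} (h : (Fin k → ℂ) → (Fin k → ℂ)) (D : Set (Fin k → ℂ)) : ℕ :=
  sSup ((fun z => Module.finrank ℂ (LinearMap.range
    ((fderiv ℂ h z : (Fin k → ℂ) →L[ℂ] (Fin k → ℂ)) : (Fin k → ℂ) →ₗ[ℂ] (Fin k → ℂ)))) '' D)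

open Metric Topology MeasureTheory

section HolomorphicBasics

variable {H E : Type*} [NormedAddCommGroup H] [NormedSpace ℂ H]
  [NormedAddCommGroup E] [NormedSpace ℂ E]

/-- Cauchy estimate: a bounded holomorphic map is Lipschitz at the centre of a ball. -/
theorem dist_le_of_norm_le_on_ball {f : H → E} {c z : H} {R M : ℝ}
    (hd : DifferentiableOn ℂ f (ball c R)) (hM : ∀ z ∈ ball c R, ‖f z‖ ≤ M) (hz : z ∈ ball c R) :
    dist (f z) (f c) ≤ 2 * M / R * dist z c := by
  have hR : 0 < R := nonempty_ball.mp ⟨_, hz⟩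
  refine Complex.dist_le_div_mul_dist_of_mapsTo_ball hd (fun w hw => ?_) hz
  rw [mem_closedBall, dist_eq_norm]
  have := norm_sub_le (f w) (f c)
  linarith [hM w hw, hM c (mem_ball_self hR)]

/-- Cauchy estimate for the derivative. -/
theorem norm_fderiv_le_of_norm_le_on_ball {f : H → E} {c : H} {R M : ℝ}
    (hd : DifferentiableOn ℂ f (ball c R)) (hM : ∀ z ∈ ball c R, ‖f z‖ ≤ M) (hR : 0 < R) :
    ‖fderiv ℂ f c‖ ≤ 2 * M / R := by
  refine Complex.norm_fderiv_le_div_of_mapsTo_ball hd (fun w hw => ?_) hR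
  rw [mem_closedBall, dist_eq_norm]
  have := norm_sub_le (f w) (f c)
  linarith [hM w hw, hM c (mem_ball_self hR)]

theorem exists_ball_norm_le_of_holomorphic {f : H → E} {U : Set H}
    (hf : DifferentiableOn ℂ f U) (hU : IsOpen U) {x : H} (hx : x ∈ U) :
    ∃ R > 0, ball x R ⊆ U ∧ ∀ z ∈ ball x R, ‖f z‖ ≤ ‖f x‖ + 1 := by
  have hc : ContinuousAt f x := hf.continuousOn.continuousAt (hU.mem_nhds hx)
  have h1 : ∀ᶠ z in 𝓝 x, ‖f z‖ < ‖f x‖ + 1 :=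
    hc.norm.eventually_lt_const (lt_add_one _)
  obtain ⟨R, hR, h⟩ := Metric.eventually_nhds_iff_ball.mp (h1.and (hU.mem_nhds hx))
  exact ⟨R, hR, fun z hz => (h z hz).2, fun z hz => (h z hz).1.le⟩

theorem continuousOn_fderiv_of_holomorphic {f : H → E} {U : Set H}
    (hf : DifferentiableOn ℂ f U) (hU : IsOpen U) : ContinuousOn (fderiv ℂ f) U := by
  intro x hx
  apply ContinuousAt.continuousWithinAt
  obtain ⟨R, hR, hRU, hM⟩ := exists_ball_norm_le_of_holomorphic hf hU hx
  set M := ‖f x‖ + 1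
  set r := R / 3 with hr
  have hr0 : 0 < r := by positivity
  have key : ∀ y ∈ ball x r, ‖fderiv ℂ f y - fderiv ℂ f x‖ ≤ 2 * (2 * M / r * dist y x) / r := by
    intro y hy
    have hyx : ‖y - x‖ < r := by simpa [dist_eq_norm] using hy
    have hshift : ∀ z ∈ ball x r, z + (y - x) ∈ ball x R := by
      intro z hz
      rw [mem_ball, dist_eq_norm] at hz ⊢
      calc ‖z + (y - x) - x‖ = ‖(z - x) + (y - x)‖ := by congr 1; abel
        _ ≤ ‖z - x‖ + ‖y - x‖ := norm_add_le _ _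
        _ < R := by linarith
    have hsub : ball x r ⊆ ball x R := ball_subset_ball (by linarith)
    have hd1 : ∀ z ∈ ball x r, DifferentiableAt ℂ (fun z => f (z + (y - x))) z := fun z hz =>
      ((hf.mono hRU).differentiableAt (isOpen_ball.mem_nhds (hshift z hz))).comp z (by fun_prop)
    have hd2 : ∀ z ∈ ball x r, DifferentiableAt ℂ f z := fun z hz =>
      (hf.mono hRU).differentiableAt (isOpen_ball.mem_nhds (hsub hz))
    have hg : DifferentiableOn ℂ (fun z => f (z + (y - x)) - f z) (ball x r) := fun z hz =>
      ((hd1 z hz).sub (hd2 z hz)).differentiableWithinAt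
    have hb : ∀ z ∈ ball x r, ‖f (z + (y - x)) - f z‖ ≤ 2 * M / r * dist y x := by
      intro z hz
      have hsub' : ball z r ⊆ ball x R := by
        refine ball_subset_ball' ?_
        rw [mem_ball] at hz; linarith
      have := dist_le_of_norm_le_on_ball (z := z + (y - x)) (hf.mono (hsub'.trans hRU))
        (fun w hw => hM w (hsub' hw)) (by simpa [dist_eq_norm] using hyx)
      simpa [dist_eq_norm] using this
    have h := norm_fderiv_le_of_norm_le_on_ball hg hb hr0
    have hx0 : x ∈ ball x r := mem_ball_self hr0
    have e : fderiv ℂ (fun z => f (z + (y - x)) - f z) x = fderiv ℂ f y - fderiv ℂ f x := by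
      rw [fderiv_fun_sub (hd1 x hx0) (hd2 x hx0), fderiv_comp_add_right]
      simp
    rwa [e] at h
  rw [ContinuousAt, tendsto_iff_norm_sub_tendsto_zero]
  refine squeeze_zero' (Eventually.of_forall fun _ => norm_nonneg _)
    (Filter.mem_of_superset (ball_mem_nhds x hr0) key) ?_
  have : Continuous fun y => 2 * (2 * M / r * dist y x) / r := by fun_prop
  simpa using this.tendsto x

/-- A holomorphic map is strictly differentiable. -/
theorem hasStrictFDerivAt_of_holomorphic {f : H → E} {U : Set H}
    (hf : DifferentiableOn ℂ f U) (hU : IsOpen U) {x : H} (hx : x ∈ U) :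
    HasStrictFDerivAt f (fderiv ℂ f x) x :=
  hasStrictFDerivAt_of_hasFDerivAt_of_continuousAt
    (Filter.mem_of_superset (hU.mem_nhds hx) fun _ hy =>
      (hf.differentiableAt (hU.mem_nhds hy)).hasFDerivAt)
    ((continuousOn_fderiv_of_holomorphic hf hU).continuousAt (hU.mem_nhds hx))

/-- Identity theorem for holomorphic maps on connected open sets. -/
theorem eqOn_zero_of_holomorphic [CompleteSpace E] {f : H → E} {U : Set H}
    (hf : DifferentiableOn ℂ f U) (hU : IsOpen U) (hc : IsPreconnected U) {x₀ : H} (hx₀ : x₀ ∈ U)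
    (h0 : ∀ᶠ z in 𝓝 x₀, f z = 0) : ∀ z ∈ U, f z = 0 := by
  have key : U ⊆ {x | ∀ᶠ z in 𝓝 x, f z = 0} := by
    refine hc.subset_of_closure_inter_subset isOpen_setOfPred_eventually_nhds ⟨x₀, hx₀, h0⟩ ?_
    rintro x ⟨hxc, hxU⟩
    obtain ⟨R, hR, hRU⟩ := Metric.isOpen_iff.mp hU x hxU
    obtain ⟨y, hy, hyx⟩ := Metric.mem_closure_iff.mp hxc (R / 4) (by positivity)
    have hyR : ball y (R / 2) ⊆ ball x R := ball_subset_ball' (by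
      rw [dist_comm]; linarith)
    refine Filter.mem_of_superset (ball_mem_nhds x (show 0 < R / 4 by positivity)) ?_
    intro z hz
    have hzy : ‖z - y‖ < R / 2 := by
      rw [← dist_eq_norm]
      have := dist_triangle z x y
      rw [mem_ball] at hz; linarith
    set L : ℂ → H := fun t => y + t • (z - y) with hL
    have hLd : Differentiable ℂ L := by fun_prop
    set D : Set ℂ := L ⁻¹' ball y (R / 2) with hD
    have hDo : IsOpen D := isOpen_ball.preimage hLd.continuous
    have hDc : Convex ℝ D := by
      have : D = {t : ℂ | ‖t • (z - y)‖ < R / 2} := by ext t; simp [hD, hL]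
      rw [this]
      intro s hs t ht a b ha hb hab
      simp only [mem_ofPred_eq, norm_smul] at hs ht ⊢
      calc ‖a • s + b • t‖ * ‖z - y‖ ≤ (a * ‖s‖ + b * ‖t‖) * ‖z - y‖ := by
            gcongr
            refine (norm_add_le _ _).trans_eq ?_
            simp [abs_of_nonneg ha, abs_of_nonneg hb]
        _ = a * (‖s‖ * ‖z - y‖) + b * (‖t‖ * ‖z - y‖) := by ring
        _ < R / 2 := by
            rcases ha.eq_or_lt with rfl | ha
            · have : b = 1 := by linarith
              subst this; linarith
            · nlinarith
    have hfD : DifferentiableOn ℂ (f ∘ L) D :=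
      (hf.mono (hyR.trans hRU)).comp hLd.differentiableOn fun t ht => ht
    have h0D : (0 : ℂ) ∈ D := by simp [hD, hL, hR]
    have h1D : (1 : ℂ) ∈ D := by simpa [hD, hL, dist_eq_norm] using hzy
    have hev : (f ∘ L) =ᶠ[𝓝 0] 0 := by
      have : Tendsto L (𝓝 0) (𝓝 y) := by simpa [hL] using hLd.continuous.tendsto 0
      exact this.eventually hy
    have := (hfD.analyticOnNhd hDo).eqOn_zero_of_preconnected_of_eventuallyEq_zero
      hDc.isPreconnected h0D hev h1D
    simpa [hL] using this
  intro z hz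
  exact (key hz).self_of_nhds

theorem uniformCauchySeqOn_fderiv_of_holomorphic {F : ℕ → H → E} {g : H → E} {x : H} {r : ℝ}
    (hr : 0 < r) (hF : ∀ n, DifferentiableOn ℂ (F n) (ball x (2 * r)))
    (h : TendstoUniformlyOn F g atTop (ball x (2 * r))) :
    UniformCauchySeqOn (fun n => fderiv ℂ (F n)) atTop (ball x r) := by
  rw [Metric.uniformCauchySeqOn_iff]
  intro ε hε
  obtain ⟨N, hN⟩ := Metric.uniformCauchySeqOn_iff.mp h.uniformCauchySeqOn (ε * r / 4)
    (by positivity)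
  refine ⟨N, fun m hm n hn y hy => ?_⟩
  have hsub : ball y r ⊆ ball x (2 * r) := ball_subset_ball' (by rw [mem_ball] at hy; linarith)
  have hy' : y ∈ ball x (2 * r) := hsub (mem_ball_self hr)
  have hd : ∀ n, DifferentiableAt ℂ (F n) y := fun n =>
    (hF n).differentiableAt (isOpen_ball.mem_nhds hy')
  have := norm_fderiv_le_of_norm_le_on_ball (f := fun z => F m z - F n z) (c := y) (R := r)
    (M := ε * r / 4) (((hF m).sub (hF n)).mono hsub)
    (fun z hz => by
      have := hN m hm n hn z (hsub hz)
      rw [dist_eq_norm] at this; exact this.le) hr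
  rw [fderiv_fun_sub (hd m) (hd n)] at this
  rw [dist_eq_norm]
  refine this.trans_lt ?_
  have : 2 * (ε * r / 4) / r = ε / 2 := by field_simp; norm_num
  rw [this]; linarith

/-- Weierstrass theorem: locally uniform limits of holomorphic maps are holomorphic, and the
derivatives converge. -/
theorem hasFDerivAt_and_tendsto_fderiv_of_holomorphic [ProperSpace H] [CompleteSpace E]
    {F : ℕ → H → E} {g : H → E} {U : Set H} (hU : IsOpen U)
    (hF : ∀ n, DifferentiableOn ℂ (F n) U) (h : TendstoLocallyUniformlyOn F g atTop U) {x : H}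
    (hx : x ∈ U) :
    DifferentiableAt ℂ g x ∧ Tendsto (fun n => fderiv ℂ (F n) x) atTop (𝓝 (fderiv ℂ g x)) := by
  obtain ⟨R, hR, hRU⟩ := Metric.isOpen_iff.mp hU x hx
  set r := R / 4 with hr
  have hr0 : 0 < r := by positivity
  have hcb : closedBall x (2 * r) ⊆ U := (closedBall_subset_ball (by linarith)).trans hRU
  have hb : ball x (2 * r) ⊆ U := ball_subset_closedBall.trans hcb
  have hun := ((tendstoLocallyUniformlyOn_iff_forall_isCompact hU).mp h _ hcb
    (isCompact_closedBall x (2 * r))).mono ball_subset_closedBall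
  have hC := uniformCauchySeqOn_fderiv_of_holomorphic hr0 (fun n => (hF n).mono hb) hun
  have hlim : ∀ y ∈ ball x r, ∃ L, Tendsto (fun n => fderiv ℂ (F n) y) atTop (𝓝 L) := fun y hy =>
    cauchySeq_tendsto_of_complete (hC.cauchySeq hy)
  choose! L hL using hlim
  have hT : TendstoUniformlyOn (fun n => fderiv ℂ (F n)) L atTop (ball x r) :=
    hC.tendstoUniformlyOn_of_tendsto hL
  have hxr : x ∈ ball x r := mem_ball_self hr0
  have hbr : ball x r ⊆ U := (ball_subset_ball (by linarith)).trans hb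
  have hD : HasFDerivAt g (L x) x := by
    refine hasFDerivAt_of_tendstoUniformlyOn (f := F) isOpen_ball hT (fun n y hy => ?_) (fun y hy => ?_) hxr
    · exact ((hF n).differentiableAt (hU.mem_nhds (hbr hy))).hasFDerivAt
    · exact h.tendsto_at (hbr hy)
  refine ⟨hD.differentiableAt, ?_⟩
  rw [hD.fderiv]
  exact hL x hxr

theorem differentiableAt_intervalIntegral_of_holomorphic [CompleteSpace E] {O : Set (H × ℂ)}
    (hO : IsOpen O) {F : H × ℂ → E} (hF : DifferentiableOn ℂ F O) {γ : ℝ → ℂ} (hγ : Continuous γ)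
    {a b : ℝ} {x₀ : H} (hx : ∀ t ∈ uIcc a b, (x₀, γ t) ∈ O) :
    DifferentiableAt ℂ (fun x => ∫ t in a..b, F (x, γ t)) x₀ := by
  have hF' := continuousOn_fderiv_of_holomorphic hF hO
  have hcont : ∀ x, ContinuousOn (fun t => ((x, γ t) : H × ℂ)) (uIcc a b) := fun x => by fun_prop
  have hc' : ContinuousOn (fun t => fderiv ℂ F (x₀, γ t)) (uIcc a b) := hF'.comp (hcont x₀) hx
  obtain ⟨M, hM⟩ := (isCompact_uIcc.image_of_continuousOn hc').isBounded.exists_norm_le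
  set O' : Set (H × ℂ) := O ∩ (fun p => ‖fderiv ℂ F p‖) ⁻¹' Iio (M + 1)
  have hO' : IsOpen O' := hF'.norm.isOpen_inter_preimage hO isOpen_Iio
  have hsub : ({x₀} : Set H) ×ˢ (γ '' uIcc a b) ⊆ O' := by
    rintro ⟨x, w⟩ ⟨hx', t, ht, rfl⟩
    obtain rfl : x = x₀ := hx'
    refine ⟨hx t ht, ?_⟩
    have := hM _ ⟨t, ht, rfl⟩
    simp only [mem_preimage, mem_Iio]
    linarith
  obtain ⟨u, v, hu, hv, hxu, hγv, huv⟩ := generalized_tube_lemma isCompact_singleton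
    (isCompact_uIcc.image hγ) hO' hsub
  have hmem : ∀ x ∈ u, ∀ t ∈ uIcc a b, (x, γ t) ∈ O' := fun x hx t ht =>
    huv ⟨hx, hγv ⟨t, ht, rfl⟩⟩
  have hxu : x₀ ∈ u := hxu rfl
  have hFc : ∀ x ∈ u, ContinuousOn (fun t => F (x, γ t)) (uIcc a b) := fun x hx =>
    hF.continuousOn.comp (hcont x) fun t ht => (hmem x hx t ht).1
  refine (intervalIntegral.hasFDerivAt_integral_of_dominated_of_fderiv_le (μ := volume)
    (F' := fun x t => (fderiv ℂ F (x, γ t)).comp (ContinuousLinearMap.inl ℂ H ℂ))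
    (bound := fun _ => M + 1) (hu.mem_nhds hxu) ?_ ?_ ?_ ?_ ?_ ?_).differentiableAt
  · filter_upwards [hu.mem_nhds hxu] with x hx
    exact ((hFc x hx).mono uIoc_subset_uIcc).aestronglyMeasurable measurableSet_uIoc
  · exact (hFc x₀ hxu).intervalIntegrable
  · refine ContinuousOn.aestronglyMeasurable ?_ measurableSet_uIoc
    exact (hc'.mono uIoc_subset_uIcc).clm_comp continuousOn_const
  · refine Eventually.of_forall fun t ht x hx => ?_
    have h1 := (hmem x hx t (uIoc_subset_uIcc ht)).2
    refine (ContinuousLinearMap.opNorm_comp_le _ _).trans ?_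
    have h2 := ContinuousLinearMap.norm_inl_le_one ℂ H ℂ
    simp only [mem_preimage, mem_Iio] at h1
    nlinarith [norm_nonneg (fderiv ℂ F (x, γ t)), norm_nonneg (ContinuousLinearMap.inl ℂ H ℂ)]
  · exact _root_.intervalIntegrable_const
  · refine Eventually.of_forall fun t ht x hx => ?_
    have h1 := (hmem x hx t (uIoc_subset_uIcc ht)).1
    have h2 := (hF.differentiableAt (hO.mem_nhds h1)).hasFDerivAt
    exact HasFDerivAt.comp x h2 (hasFDerivAt_prodMk_left x (γ t))

end HolomorphicBasics

section RectangleCauchy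

open Complex

variable {E : Type*} [NormedAddCommGroup E] [NormedSpace ℂ E]

/-- The integral over the boundary of the rectangle `[x₀, x₁] × [y₀, y₁]`, side by side:
bottom, top, right, left. -/
noncomputable def rectSide (x₀ x₁ y₀ y₁ : ℝ) (g : ℂ → E) : Fin 4 → E :=
  ![∫ x : ℝ in x₀..x₁, g (x + y₀ * I), -∫ x : ℝ in x₀..x₁, g (x + y₁ * I),
    I • ∫ y : ℝ in y₀..y₁, g (x₁ + y * I), -(I • ∫ y : ℝ in y₀..y₁, g (x₀ + y * I))]

theorem log_neg_of_im_pos {z : ℂ} (hz : 0 < z.im) : log (-z) = log z - Real.pi * I := by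
  simp only [log, norm_neg, arg_neg_eq_arg_sub_pi_of_im_pos hz]
  push_cast; ring

theorem log_neg_of_im_neg {z : ℂ} (hz : z.im < 0) : log (-z) = log z + Real.pi * I := by
  simp only [log, norm_neg, arg_neg_eq_arg_add_pi_of_im_neg hz]
  push_cast; ring

theorem sum_rectSide_inv {x₀ x₁ y₀ y₁ : ℝ} {w : ℂ} (hx₀ : x₀ < w.re) (hx₁ : w.re < x₁)
    (hy₀ : y₀ < w.im) (hy₁ : w.im < y₁) :
    ∑ s, rectSide x₀ x₁ y₀ y₁ (fun ζ => (ζ - w)⁻¹) s = 2 * Real.pi * I := by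
  have hh : ∀ (y : ℝ), y ≠ w.im → ∀ x : ℝ, (x + y * I - w) ∈ slitPlane := fun y hy x => by
    refine Or.inr ?_
    simpa [sub_eq_zero] using hy
  have hb : ∀ y : ℝ, y ≠ w.im → ∫ x : ℝ in x₀..x₁, (x + y * I - w : ℂ)⁻¹ =
      log (x₁ + y * I - w) - log (x₀ + y * I - w) := fun y hy => by
    refine intervalIntegral.integral_eq_sub_of_hasDerivAt
      (f := fun x : ℝ => log (x + y * I - w)) (fun x _ => ?_) ?_
    · have h1 : HasDerivAt (fun x : ℝ => (x + y * I - w : ℂ)) 1 x :=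
        ((ofRealCLM.hasDerivAt (x := x)).add_const _).sub_const _
      simpa using h1.clog_real (hh y hy x)
    · refine ContinuousOn.intervalIntegrable (ContinuousOn.inv₀ (by fun_prop) fun x _ => ?_)
      exact slitPlane_ne_zero (hh y hy x)
  have hr : I • ∫ y : ℝ in y₀..y₁, (x₁ + y * I - w : ℂ)⁻¹ =
      log (x₁ + y₁ * I - w) - log (x₁ + y₀ * I - w) := by
    have hs : ∀ y : ℝ, (x₁ + y * I - w) ∈ slitPlane := fun y => Or.inl (by simpa using hx₁)
    rw [← intervalIntegral.integral_smul]
    refine intervalIntegral.integral_eq_sub_of_hasDerivAt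
      (f := fun y : ℝ => log (x₁ + y * I - w)) (fun y _ => ?_) ?_
    · have h1 : HasDerivAt (fun y : ℝ => (x₁ + y * I - w : ℂ)) I y := by
        simpa using (((ofRealCLM.hasDerivAt (x := y)).mul_const I).const_add (x₁ : ℂ)).sub_const w
      simpa [div_eq_mul_inv] using h1.clog_real (hs y)
    · refine ContinuousOn.intervalIntegrable ((ContinuousOn.inv₀ (by fun_prop) fun x _ => ?_).const_smul I)
      exact slitPlane_ne_zero (hs x)
  have hl : I • ∫ y : ℝ in y₀..y₁, (x₀ + y * I - w : ℂ)⁻¹ =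
      log (-(x₀ + y₁ * I - w)) - log (-(x₀ + y₀ * I - w)) := by
    have hs : ∀ y : ℝ, (-(x₀ + y * I - w)) ∈ slitPlane := fun y => Or.inl (by simpa using hx₀)
    rw [← intervalIntegral.integral_smul]
    refine intervalIntegral.integral_eq_sub_of_hasDerivAt
      (f := fun y : ℝ => log (-(x₀ + y * I - w))) (fun y _ => ?_) ?_
    · have h1 : HasDerivAt (fun y : ℝ => (-(x₀ + y * I - w) : ℂ)) (-I) y := by
        simpa using ((((ofRealCLM.hasDerivAt (x := y)).mul_const I).const_add
          (x₀ : ℂ)).sub_const w).fun_neg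
      have := h1.clog_real (hs y)
      rwa [neg_div_neg_eq, div_eq_mul_inv] at this
    · refine ContinuousOn.intervalIntegrable ((ContinuousOn.inv₀ (by fun_prop) fun x _ => ?_).const_smul I)
      exact neg_ne_zero.mp (slitPlane_ne_zero (hs x))
  have e1 := log_neg_of_im_pos (z := x₀ + y₁ * I - w) (by simpa using hy₁)
  have e2 := log_neg_of_im_neg (z := x₀ + y₀ * I - w) (by simpa using hy₀)
  simp only [rectSide, Fin.sum_univ_four, Matrix.cons_val]
  rw [hb y₀ hy₀.ne, hb y₁ hy₁.ne', hr, hl, e1, e2]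
  ring

/-- Cauchy integral formula for a rectangle. -/
theorem sum_rectSide_eq [CompleteSpace E] {x₀ x₁ y₀ y₁ : ℝ} {w : ℂ} {g : ℂ → E} {O : Set ℂ}
    (hO : IsOpen O) (hg : DifferentiableOn ℂ g O)
    (hR : Icc x₀ x₁ ×ℂ Icc y₀ y₁ ⊆ O) (hx₀ : x₀ < w.re) (hx₁ : w.re < x₁)
    (hy₀ : y₀ < w.im) (hy₁ : w.im < y₁) :
    ∑ s, rectSide x₀ x₁ y₀ y₁ (fun ζ => (ζ - w)⁻¹ • g ζ) s = (2 * Real.pi * I : ℂ) • g w := by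
  have hwO : w ∈ O := hR ⟨⟨hx₀.le, hx₁.le⟩, ⟨hy₀.le, hy₁.le⟩⟩
  have hds : DifferentiableOn ℂ (dslope g w) O :=
    (differentiableOn_dslope (hO.mem_nhds hwO)).mpr hg
  have h0 := integral_boundary_rect_eq_zero_of_differentiableOn (dslope g w) (x₀ + y₀ * I)
    (x₁ + y₁ * I) (hds.mono (by
      simpa [uIcc_of_le (hx₀.trans hx₁).le, uIcc_of_le (hy₀.trans hy₁).le] using hR))
  simp only [add_re, ofReal_re, mul_re, I_re, mul_zero, ofReal_im, I_im, mul_one, sub_self,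
    add_zero, add_im, mul_im, zero_add] at h0
  have hx := (hx₀.trans hx₁).le
  have hy := (hy₀.trans hy₁).le
  have key : ∀ (c d : ℝ) (γ : ℝ → ℂ), Continuous γ → (∀ t, γ t ≠ w) →
      (∀ t ∈ uIcc c d, γ t ∈ O) →
      ∫ t in c..d, dslope g w (γ t) =
        (∫ t in c..d, (γ t - w)⁻¹ • g (γ t)) - (∫ t in c..d, (γ t - w)⁻¹) • g w := by
    intro c d γ hγ hne hm
    have hci : ContinuousOn (fun t => (γ t - w)⁻¹) (uIcc c d) :=
      ContinuousOn.inv₀ (by fun_prop) fun t _ => sub_ne_zero.mpr (hne t)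
    have hcg : ContinuousOn (fun t => g (γ t)) (uIcc c d) :=
      hg.continuousOn.comp hγ.continuousOn hm
    rw [← intervalIntegral.integral_smul_const, ← intervalIntegral.integral_sub]
    · refine intervalIntegral.integral_congr fun t _ => ?_
      simp only [dslope_of_ne _ (hne t), slope_def_module, smul_sub]
    · exact (hci.smul hcg).intervalIntegrable
    · exact (hci.smul continuousOn_const).intervalIntegrable
  have hne : ∀ x y : ℝ, (x ≠ w.re ∨ y ≠ w.im) → (x + y * I : ℂ) ≠ w := by
    rintro x y h rfl
    simp at h
  have hmem : ∀ x ∈ Icc x₀ x₁, ∀ y ∈ Icc y₀ y₁, (x + y * I : ℂ) ∈ O := fun x hx y hy =>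
    hR (by simpa [mem_reProdIm] using ⟨hx, hy⟩)
  rw [key x₀ x₁ (fun x => x + y₀ * I) (by fun_prop) (fun t => hne _ _ (.inr hy₀.ne))
      (fun t ht => hmem _ (uIcc_of_le hx ▸ ht) _ ⟨le_rfl, hy⟩),
    key x₀ x₁ (fun x => x + y₁ * I) (by fun_prop) (fun t => hne _ _ (.inr hy₁.ne'))
      (fun t ht => hmem _ (uIcc_of_le hx ▸ ht) _ ⟨hy, le_rfl⟩),
    key y₀ y₁ (fun y => x₁ + y * I) (by fun_prop) (fun t => hne _ _ (.inl hx₁.ne'))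
      (fun t ht => hmem _ ⟨hx, le_rfl⟩ _ (uIcc_of_le hy ▸ ht)),
    key y₀ y₁ (fun y => x₀ + y * I) (by fun_prop) (fun t => hne _ _ (.inl hx₀.ne))
      (fun t ht => hmem _ ⟨le_rfl, hx⟩ _ (uIcc_of_le hy ▸ ht))] at h0
  rw [← sum_rectSide_inv hx₀ hx₁ hy₀ hy₁]
  simp only [rectSide, Fin.sum_univ_four, Matrix.cons_val, add_smul, neg_smul, smul_assoc]
  rw [← sub_eq_zero, ← h0]
  simp only [smul_sub]
  abel

end RectangleCauchy

section Boxes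

variable {k : ℕ}

/-- The real coordinates of `ℂ^k`: `(j, true)` is `Re z_j` and `(j, false)` is `Im z_j`. -/
def realCoord (i : Fin k × Bool) (z : Fin k → ℂ) : ℝ := if i.2 then (z i.1).re else (z i.1).im

@[simp] theorem realCoord_true (j : Fin k) (z : Fin k → ℂ) :
    realCoord (j, true) z = (z j).re := rfl

@[simp] theorem realCoord_false (j : Fin k) (z : Fin k → ℂ) :
    realCoord (j, false) z = (z j).im := rfl

theorem continuous_realCoord (i : Fin k × Bool) : Continuous (realCoord i) := by
  obtain ⟨j, _ | _⟩ := i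
  · exact Complex.continuous_im.comp (continuous_apply j)
  · exact Complex.continuous_re.comp (continuous_apply j)

/-- Closed boxes in `ℂ^k = ℝ^{2k}`. -/
def realBox (a b : Fin k × Bool → ℝ) : Set (Fin k → ℂ) :=
  {z | ∀ i, realCoord i z ∈ Icc (a i) (b i)}

theorem norm_sub_le_of_realCoord {z w : Fin k → ℂ} {ε : ℝ} (hε : 0 ≤ ε)
    (h : ∀ i, |realCoord i z - realCoord i w| ≤ ε) : ‖z - w‖ ≤ 2 * ε := by
  refine (pi_norm_le_iff_of_nonneg (by positivity)).mpr fun j => ?_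
  have h1 := h (j, true)
  have h2 := h (j, false)
  have h3 := Complex.norm_le_abs_re_add_abs_im ((z - w) j)
  simp only [realCoord_true, realCoord_false, Pi.sub_apply, Complex.sub_re,
    Complex.sub_im] at h1 h2 h3 ⊢
  linarith

theorem isClosed_realBox (a b : Fin k × Bool → ℝ) : IsClosed (realBox a b) := by
  have : realBox a b = ⋂ i, realCoord i ⁻¹' Icc (a i) (b i) := by
    ext z; simp [realBox]
  rw [this]
  exact isClosed_iInter fun i => isClosed_Icc.preimage (continuous_realCoord i)

theorem isCompact_realBox (a b : Fin k × Bool → ℝ) : IsCompact (realBox a b) := by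
  refine Metric.isCompact_of_isClosed_isBounded (isClosed_realBox a b) ?_
  refine (Metric.isBounded_iff).mpr ⟨2 * ∑ i, |b i - a i|, fun z hz w hw => ?_⟩
  rw [dist_eq_norm]
  refine norm_sub_le_of_realCoord (Finset.sum_nonneg fun _ _ => abs_nonneg _) fun i => ?_
  refine le_trans ?_ (Finset.single_le_sum (f := fun i => |b i - a i|)
    (fun _ _ => abs_nonneg _) (Finset.mem_univ i))
  have h1 := hz i
  have h2 := hw i
  simp only [mem_Icc] at h1 h2
  exact (abs_sub_le_of_le_of_le h1.1 h1.2 h2.1 h2.2).trans (le_abs_self _)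

/-- `g` is holomorphic on a neighbourhood of `Y`. -/
def HolNear {E : Type*} [NormedAddCommGroup E] [NormedSpace ℂ E] (Y : Set (Fin k → ℂ))
    (g : (Fin k → ℂ) → E) : Prop :=
  ∀ᶠ z in 𝓝ˢ Y, DifferentiableAt ℂ g z

theorem HolNear.exists_isOpen {E : Type*} [NormedAddCommGroup E] [NormedSpace ℂ E]
    {Y : Set (Fin k → ℂ)} {g : (Fin k → ℂ) → E} (h : HolNear Y g) :
    ∃ O, IsOpen O ∧ Y ⊆ O ∧ DifferentiableOn ℂ g O := by
  obtain ⟨O, hO, hY, hg⟩ := mem_nhdsSet_iff_exists.mp h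
  exact ⟨O, hO, hY, fun z hz => (hg hz).differentiableWithinAt⟩

theorem HolNear.of_isOpen {E : Type*} [NormedAddCommGroup E] [NormedSpace ℂ E]
    {Y O : Set (Fin k → ℂ)} {g : (Fin k → ℂ) → E} (hO : IsOpen O) (hY : Y ⊆ O)
    (hg : DifferentiableOn ℂ g O) : HolNear Y g :=
  mem_nhdsSet_iff_exists.mpr ⟨O, hO, hY, fun _ hz => hg.differentiableAt (hO.mem_nhds hz)⟩

/-- Additive splitting along a face: whenever a box is cut into two boxes by a real coordinate
hyperplane, a Banach space valued function holomorphic near `Y ∩ face` is the difference of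
functions holomorphic near the intersections of `Y` with the two halves. -/
def SplitsOn (Y : Set (Fin k → ℂ)) : Prop :=
  ∀ (E : Type) [NormedAddCommGroup E] [NormedSpace ℂ E] [CompleteSpace E]
    (a b : Fin k × Bool → ℝ) (i : Fin k × Bool) (t : ℝ), t ∈ Icc (a i) (b i) →
    ∀ d : (Fin k → ℂ) → E,
      HolNear (Y ∩ realBox (Function.update a i t) (Function.update b i t)) d →
      ∃ d₁ d₂ : (Fin k → ℂ) → E, HolNear (Y ∩ realBox a (Function.update b i t)) d₁ ∧
        HolNear (Y ∩ realBox (Function.update a i t) b) d₂ ∧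
        ∀ᶠ z in 𝓝ˢ (Y ∩ realBox (Function.update a i t) (Function.update b i t)),
          d z = d₁ z - d₂ z

section Base

variable {E : Type*} [NormedAddCommGroup E] [NormedSpace ℂ E] [CompleteSpace E]

theorem eventually_differentiableAt_cauchyIntegral {O : Set (Fin k → ℂ)} (hO : IsOpen O)
    {d : (Fin k → ℂ) → E} (hd : DifferentiableOn ℂ d O) (j : Fin k) {γ : ℝ → ℂ}
    (hγ : Continuous γ) {c e : ℝ} {z : Fin k → ℂ}
    (hz : ∀ t ∈ uIcc c e, Function.update z j (γ t) ∈ O ∧ γ t ≠ z j) :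
    ∀ᶠ w in 𝓝 z, DifferentiableAt ℂ
      (fun w => ∫ t in c..e, (γ t - w j)⁻¹ • d (Function.update w j (γ t))) w := by
  have hup : Differentiable ℂ fun p : (Fin k → ℂ) × ℂ => Function.update p.1 j p.2 := by
    rw [differentiable_pi]
    intro l
    by_cases h : l = j
    · subst h; simp only [Function.update_self]; exact differentiable_snd
    · simp only [Function.update_of_ne h]; fun_prop
  set O₂ : Set ((Fin k → ℂ) × ℂ) :=
    {p | Function.update p.1 j p.2 ∈ O ∧ p.2 ≠ p.1 j} with hO₂
  have hO₂o : IsOpen O₂ := (hO.preimage hup.continuous).inter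
    (isOpen_ne_fun continuous_snd ((continuous_apply j).comp continuous_fst))
  have hF : DifferentiableOn ℂ (fun p : (Fin k → ℂ) × ℂ =>
      (p.2 - p.1 j)⁻¹ • d (Function.update p.1 j p.2)) O₂ := by
    refine DifferentiableOn.smul (DifferentiableOn.inv (by fun_prop)
      fun p hp => sub_ne_zero.mpr hp.2) ?_
    exact hd.comp hup.differentiableOn fun p hp => hp.1
  have hev : ∀ᶠ w in 𝓝 z, ∀ t ∈ uIcc c e, (w, γ t) ∈ O₂ := by
    refine isCompact_uIcc.eventually_forall_of_forall_eventually fun t ht => ?_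
    have : Continuous fun p : (Fin k → ℂ) × ℝ => (p.1, γ p.2) := by fun_prop
    exact this.continuousAt.eventually (hO₂o.mem_nhds (hz t ht))
  filter_upwards [hev] with w hw
  exact differentiableAt_intervalIntegral_of_holomorphic hO₂o hF hγ hw

theorem eventually_differentiableAt_rectSide {O : Set (Fin k → ℂ)} (hO : IsOpen O)
    {d : (Fin k → ℂ) → E} (hd : DifferentiableOn ℂ d O) (j : Fin k) {x₀ x₁ y₀ y₁ : ℝ}
    (hx : x₀ ≤ x₁) (hy : y₀ ≤ y₁) {z : Fin k → ℂ}
    (hz : ∀ ζ ∈ Icc x₀ x₁ ×ℂ Icc y₀ y₁, Function.update z j ζ ∈ O) (s : Fin 4)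
    (hs : ![(z j).im ≠ y₀, (z j).im ≠ y₁, (z j).re ≠ x₁, (z j).re ≠ x₀] s) :
    ∀ᶠ w in 𝓝 z, DifferentiableAt ℂ (fun w => rectSide x₀ x₁ y₀ y₁
      (fun ζ => (ζ - w j)⁻¹ • d (Function.update w j ζ)) s) w := by
  have hm : ∀ x ∈ uIcc x₀ x₁, ∀ y ∈ uIcc y₀ y₁,
      Function.update z j (x + y * Complex.I : ℂ) ∈ O := fun x hx' y hy' =>
    hz _ (by simpa [Complex.mem_reProdIm, uIcc_of_le hx, uIcc_of_le hy] using And.intro hx' hy')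
  fin_cases s
  · filter_upwards [eventually_differentiableAt_cauchyIntegral (c := x₀) (e := x₁) hO hd j
      (γ := fun x => x + y₀ * Complex.I) (by fun_prop) fun t ht =>
      ⟨hm t ht y₀ left_mem_uIcc, fun h => hs (by simp [← h])⟩] with w hw
    simpa [rectSide] using hw
  · filter_upwards [eventually_differentiableAt_cauchyIntegral (c := x₀) (e := x₁) hO hd j
      (γ := fun x => x + y₁ * Complex.I) (by fun_prop) fun t ht =>
      ⟨hm t ht y₁ right_mem_uIcc, fun h => hs (by simp [← h])⟩] with w hw
    simpa [rectSide] using hw.fun_neg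
  · filter_upwards [eventually_differentiableAt_cauchyIntegral (c := y₀) (e := y₁) hO hd j
      (γ := fun y => x₁ + y * Complex.I) (by fun_prop) fun t ht =>
      ⟨hm x₁ right_mem_uIcc t ht, fun h => hs (by simp [← h])⟩] with w hw
    simpa [rectSide] using hw.fun_const_smul Complex.I
  · filter_upwards [eventually_differentiableAt_cauchyIntegral (c := y₀) (e := y₁) hO hd j
      (γ := fun y => x₀ + y * Complex.I) (by fun_prop) fun t ht =>
      ⟨hm x₀ left_mem_uIcc t ht, fun h => hs (by simp [← h])⟩] with w hw
    simpa [rectSide] using (hw.fun_const_smul Complex.I).fun_neg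

end Base

theorem exists_mem_Icc_abs_sub_le {a b x ε : ℝ} (hab : a ≤ b) (hε : 0 ≤ ε)
    (hx : x ∈ Icc (a - ε) (b + ε)) : ∃ y ∈ Icc a b, |x - y| ≤ ε := by
  rcases le_total x a with h | h
  · exact ⟨a, ⟨le_rfl, hab⟩, abs_le.mpr ⟨by linarith [hx.1], by linarith⟩⟩
  rcases le_total x b with h' | h'
  · exact ⟨x, ⟨h, h'⟩, by simpa using hε⟩
  · exact ⟨b, ⟨hab, le_rfl⟩, abs_le.mpr ⟨by linarith, by linarith [hx.2]⟩⟩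

theorem splitsOn_univ : SplitsOn (univ : Set (Fin k → ℂ)) := by
  intro E _ _ _ a b i t ht d hd
  simp only [univ_inter] at hd ⊢
  set a' := Function.update a i t with ha'
  set b' := Function.update b i t with hb'
  obtain ⟨O, hO, hfO, hdO⟩ := hd.exists_isOpen
  obtain ⟨δ, hδ, hδO⟩ := (isCompact_realBox a' b').exists_thickening_subset_open hO hfO
  set ε := δ / 3 with hε
  have hε0 : 0 < ε := by positivity
  obtain ⟨j, β⟩ := i
  set x₀ := a' (j, true) - ε
  set x₁ := b' (j, true) + ε
  set y₀ := a' (j, false) - ε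
  set y₁ := b' (j, false) + ε
  have hmem : ∀ z : Fin k → ℂ, (∀ i : Fin k × Bool, i.1 ≠ j → realCoord i z ∈ Icc (a i) (b i)) →
      (∀ β, a' (j, β) ≤ b' (j, β)) →
      ∀ ζ ∈ Icc x₀ x₁ ×ℂ Icc y₀ y₁, Function.update z j ζ ∈ O := by
    intro z hz hab ζ hζ
    obtain ⟨p, hp, hp'⟩ := exists_mem_Icc_abs_sub_le (hab true) hε0.le hζ.1
    obtain ⟨q, hq, hq'⟩ := exists_mem_Icc_abs_sub_le (hab false) hε0.le hζ.2
    refine hδO (mem_thickening_iff.mpr ⟨Function.update z j ⟨p, q⟩, ?_, ?_⟩)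
    · rintro ⟨l, β'⟩
      by_cases hl : l = j
      · subst hl; cases β' <;> simpa
      · have h1 : ((l, β') : Fin k × Bool) ≠ (j, β) := fun h => hl (congrArg Prod.fst h)
        have h2 : realCoord (l, β') (Function.update z j ⟨p, q⟩) = realCoord (l, β') z := by
          cases β' <;> simp [Function.update_of_ne hl]
        rw [h2, ha', hb', Function.update_of_ne h1, Function.update_of_ne h1]
        exact hz _ hl
    · rw [dist_eq_norm]
      refine (norm_sub_le_of_realCoord hε0.le ?_).trans_lt (by linarith : 2 * ε < δ)
      rintro ⟨l, β'⟩
      by_cases hl : l = j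
      · subst hl; cases β' <;> simpa
      · cases β' <;> simp [Function.update_of_ne hl, hε0.le]
  set D : Fin 4 → (Fin k → ℂ) → E := fun s w => rectSide x₀ x₁ y₀ y₁
      (fun ζ => (ζ - w j)⁻¹ • d (Function.update w j ζ)) s with hD
  set c : ℂ := (2 * Real.pi * Complex.I)⁻¹ with hc
  have hc0 : (2 * Real.pi * Complex.I : ℂ) ≠ 0 := Complex.two_pi_I_ne_zero
  have hDs : ∀ z : Fin k → ℂ, (∀ i : Fin k × Bool, i.1 ≠ j → realCoord i z ∈ Icc (a i) (b i)) →
      (∀ β, a' (j, β) ≤ b' (j, β)) → ∀ s : Fin 4,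
      ![(z j).im ≠ y₀, (z j).im ≠ y₁, (z j).re ≠ x₁, (z j).re ≠ x₀] s →
      ∀ᶠ w in 𝓝 z, DifferentiableAt ℂ (D s) w := fun z hz hab s hs =>
    eventually_differentiableAt_rectSide hO hdO j (by linarith [hab true]) (by linarith [hab false])
      (hmem z hz hab) s hs
  have hlt : ∀ β', β' ≠ β → ∀ z ∈ realBox a b' ∪ realBox a' b,
      realCoord (j, β') z ∈ Icc (a' (j, β')) (b' (j, β')) := by
    intro β' hβ z hz
    have h1 : ((j, β') : Fin k × Bool) ≠ (j, β) := fun h => hβ (congrArg Prod.snd h)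
    rcases hz with hz | hz <;> have := hz (j, β') <;>
      simpa [ha', hb', Function.update_of_ne h1] using this
  have hcoord : ∀ z ∈ realBox a b' ∪ realBox a' b,
      (∀ i : Fin k × Bool, i.1 ≠ j → realCoord i z ∈ Icc (a i) (b i)) := by
    intro z hz i hi
    have h1 : i ≠ (j, β) := fun h => hi (congrArg Prod.fst h)
    rcases hz with hz | hz <;> have := hz i <;>
      simpa [ha', hb', Function.update_of_ne h1] using this
  have hβa : a' (j, β) = t := by simp [ha']
  have hβb : b' (j, β) = t := by simp [hb']
  have hab : ∀ z ∈ realBox a b' ∪ realBox a' b, ∀ β', a' (j, β') ≤ b' (j, β') := by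
    intro z hz β'
    by_cases h : β' = β
    · rw [h, hβa, hβb]
    · exact (hlt β' h z hz).1.trans (hlt β' h z hz).2
  obtain ⟨s₀, hs₁, hs₂⟩ : ∃ s₀ : Fin 4,
      (∀ z ∈ realBox a b', ∀ s ≠ s₀,
        ![(z j).im ≠ y₀, (z j).im ≠ y₁, (z j).re ≠ x₁, (z j).re ≠ x₀] s) ∧
      (∀ z ∈ realBox a' b,
        ![(z j).im ≠ y₀, (z j).im ≠ y₁, (z j).re ≠ x₁, (z j).re ≠ x₀] s₀) := by
    cases β
    · refine ⟨0, fun z hz s hs => ?_, fun z hz => ?_⟩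
      · have h1 := hlt true (by decide) z (.inl hz)
        have h2 := hz (j, false)
        simp only [realCoord_true, realCoord_false, mem_Icc] at h1 h2
        fin_cases s
        · exact absurd rfl hs
        · exact ne_of_lt (by linarith)
        · exact ne_of_lt (by linarith)
        · exact ne_of_gt (by linarith)
      · have h2 := hz (j, false)
        simp only [realCoord_false, mem_Icc] at h2
        exact ne_of_gt (by linarith)
    · refine ⟨3, fun z hz s hs => ?_, fun z hz => ?_⟩
      · have h1 := hlt false (by decide) z (.inl hz)
        have h2 := hz (j, true)
        simp only [realCoord_true, realCoord_false, mem_Icc] at h1 h2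
        fin_cases s
        · exact ne_of_gt (by linarith)
        · exact ne_of_lt (by linarith)
        · exact ne_of_lt (by linarith)
        · exact absurd rfl hs
      · have h2 := hz (j, true)
        simp only [realCoord_true, mem_Icc] at h2
        exact ne_of_gt (by linarith)
  refine ⟨fun z => c • ∑ s ∈ Finset.univ.erase s₀, D s z, fun z => -(c • D s₀ z), ?_, ?_, ?_⟩
  · refine eventually_nhdsSet_iff_forall.mpr fun z hz => ?_
    have hev : ∀ᶠ w in 𝓝 z, ∀ s ∈ Finset.univ.erase s₀, DifferentiableAt ℂ (D s) w :=
      (Finset.eventually_all _).mpr fun s hs => hDs z (hcoord z (.inl hz)) (hab z (.inl hz)) s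
        (hs₁ z hz s (Finset.ne_of_mem_erase hs))
    filter_upwards [hev] with w hw
    exact (DifferentiableAt.fun_sum hw).const_smul c
  · refine eventually_nhdsSet_iff_forall.mpr fun z hz => ?_
    filter_upwards [hDs z (hcoord z (.inr hz)) (hab z (.inr hz)) s₀ (hs₂ z hz)] with w hw
    exact (hw.const_smul c).neg
  · refine eventually_nhdsSet_iff_forall.mpr fun z hz => ?_
    have hzu : z ∈ realBox a b' := fun i => by
      by_cases h : i = (j, β)
      · subst h
        have := hz (j, β)
        rw [hβa, hβb] at this
        rw [hβb]
        exact ⟨ht.1.trans this.1, this.2⟩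
      · have := hz i
        rwa [ha', Function.update_of_ne h] at this
    have hw1 : ∀ᶠ w in 𝓝 z, ∀ ζ ∈ Icc x₀ x₁ ×ℂ Icc y₀ y₁, Function.update w j ζ ∈ O := by
      refine (isCompact_Icc.reProdIm isCompact_Icc).eventually_forall_of_forall_eventually
        fun ζ hζ => ?_
      have : Continuous fun p : (Fin k → ℂ) × ℂ => Function.update p.1 j p.2 := by fun_prop
      exact this.continuousAt.eventually
        (hO.mem_nhds (hmem z (hcoord z (.inl hzu)) (hab z (.inl hzu)) ζ hζ))
    have hT := hz (j, true)
    have hF := hz (j, false)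
    simp only [realCoord_true, realCoord_false, mem_Icc] at hT hF
    have cre : Continuous fun w : Fin k → ℂ => (w j).re := by fun_prop
    have cim : Continuous fun w : Fin k → ℂ => (w j).im := by fun_prop
    filter_upwards [hw1, cre.continuousAt.eventually_lt_const (show (z j).re < x₁ by linarith),
      cre.continuousAt.eventually_const_lt (show x₀ < (z j).re by linarith),
      cim.continuousAt.eventually_lt_const (show (z j).im < y₁ by linarith),
      cim.continuousAt.eventually_const_lt (show y₀ < (z j).im by linarith)] with w hw h1 h2 h3 h4
    have hcont : Differentiable ℂ fun ζ : ℂ => Function.update w j ζ := by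
      rw [differentiable_pi]
      intro l
      by_cases h : l = j
      · subst h; simp only [Function.update_self]; exact differentiable_id
      · simp only [Function.update_of_ne h]; fun_prop
    have := sum_rectSide_eq (w := w j) (g := fun ζ => d (Function.update w j ζ))
      (hO.preimage hcont.continuous) (hdO.comp hcont.differentiableOn fun _ h => h) hw h2 h1 h4 h3
    simp only [Function.update_eq_self] at this
    rw [sub_neg_eq_add, ← smul_add, Finset.sum_erase_add _ _ (Finset.mem_univ s₀)]
    simp only [hD]
    rw [this, smul_smul, hc, inv_mul_cancel₀ hc0, one_smul]

end Boxes

section Cousin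

variable {k : ℕ} {E : Type} [NormedAddCommGroup E] [NormedSpace ℂ E]

/-- Near `X`, the function `s` on `A ∩ B` is a difference of functions holomorphic on `A` and
on `B`. -/
def CousinSolvable (A B : Set (Fin k → ℂ)) (s : (Fin k → ℂ) → E) (X : Set (Fin k → ℂ)) : Prop :=
  ∃ (N : Set (Fin k → ℂ)) (u v : (Fin k → ℂ) → E), IsOpen N ∧ X ⊆ N ∧
    DifferentiableOn ℂ u (A ∩ N) ∧ DifferentiableOn ℂ v (B ∩ N) ∧
    ∀ z ∈ A ∩ B ∩ N, u z - v z = s z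

theorem CousinSolvable.mono {A B X X' : Set (Fin k → ℂ)} {s : (Fin k → ℂ) → E}
    (h : CousinSolvable A B s X) (hX : X' ⊆ X) : CousinSolvable A B s X' := by
  obtain ⟨N, u, v, hN, hXN, h⟩ := h
  exact ⟨N, u, v, hN, hX.trans hXN, h⟩

theorem IsCompact.exists_isOpen_inter_subset {X : Type*} [TopologicalSpace X] [T2Space X]
    {K₁ K₂ O : Set X} (h₁ : IsCompact K₁) (h₂ : IsCompact K₂) (hO : IsOpen O)
    (h : K₁ ∩ K₂ ⊆ O) :
    ∃ N₁ N₂, IsOpen N₁ ∧ IsOpen N₂ ∧ K₁ ⊆ N₁ ∧ K₂ ⊆ N₂ ∧ N₁ ∩ N₂ ⊆ O := by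
  obtain ⟨P, Q, hP, hQ, hKP, hKQ, hd⟩ := (SeparatedNhds.of_isCompact_isCompact (h₁.diff hO) h₂
    (Set.disjoint_left.mpr fun x hx hx' => hx.2 (h ⟨hx.1, hx'⟩)))
  refine ⟨P ∪ O, Q, hP.union hO, hQ, fun x hx => ?_, hKQ, ?_⟩
  · by_cases hxO : x ∈ O
    · exact .inr hxO
    · exact .inl (hKP ⟨hx, hxO⟩)
  · rintro x ⟨hx | hx, hxQ⟩
    · exact absurd hxQ (Set.disjoint_left.mp hd hx)
    · exact hx

theorem differentiableAt_of_eqOn_isOpen {f g : (Fin k → ℂ) → E} {O : Set (Fin k → ℂ)}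
    (hO : IsOpen O) (hg : DifferentiableOn ℂ g O) (h : ∀ z ∈ O, f z = g z) {z : Fin k → ℂ}
    (hz : z ∈ O) : DifferentiableAt ℂ f z :=
  (hg.differentiableAt (hO.mem_nhds hz)).congr_of_eventuallyEq
    (Filter.mem_of_superset (hO.mem_nhds hz) h)

open Classical in
theorem CousinSolvable.union {A B X₁ X₂ : Set (Fin k → ℂ)} {s : (Fin k → ℂ) → E}
    (hA : IsOpen A) (hB : IsOpen B) (hX₁ : IsCompact X₁) (hX₂ : IsCompact X₂)
    (hcov : X₁ ∩ X₂ ⊆ A ∪ B)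
    (hsplit : ∀ d : (Fin k → ℂ) → E, HolNear (X₁ ∩ X₂) d → ∃ d₁ d₂ : (Fin k → ℂ) → E,
      HolNear X₁ d₁ ∧ HolNear X₂ d₂ ∧ ∀ᶠ z in 𝓝ˢ (X₁ ∩ X₂), d z = d₁ z - d₂ z)
    (h₁ : CousinSolvable A B s X₁) (h₂ : CousinSolvable A B s X₂) :
    CousinSolvable A B s (X₁ ∪ X₂) := by
  obtain ⟨N₁, u₁, v₁, hN₁, hXN₁, hu₁, hv₁, hs₁⟩ := h₁
  obtain ⟨N₂, u₂, v₂, hN₂, hXN₂, hu₂, hv₂, hs₂⟩ := h₂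
  set d : (Fin k → ℂ) → E := fun z => if z ∈ A then u₁ z - u₂ z else v₁ z - v₂ z with hd
  have hdA : ∀ z ∈ A, d z = u₁ z - u₂ z := fun z hz => if_pos hz
  have hdB : ∀ z ∈ B ∩ (N₁ ∩ N₂), d z = v₁ z - v₂ z := by
    rintro z ⟨hzB, hz₁, hz₂⟩
    by_cases hzA : z ∈ A
    · rw [hdA z hzA]
      have e1 := hs₁ z ⟨⟨hzA, hzB⟩, hz₁⟩
      have e2 := hs₂ z ⟨⟨hzA, hzB⟩, hz₂⟩
      rw [← e2] at e1
      rw [sub_eq_sub_iff_add_eq_add] at e1 ⊢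
      rw [e1, add_comm]
    · exact if_neg hzA
  have hdhol : HolNear (X₁ ∩ X₂) d := by
    refine HolNear.of_isOpen ((hN₁.inter hN₂).inter (hA.union hB))
      (fun z hz => ⟨⟨hXN₁ hz.1, hXN₂ hz.2⟩, hcov hz⟩) ?_
    rintro z ⟨⟨hz₁, hz₂⟩, hzA | hzB⟩
    · exact (differentiableAt_of_eqOn_isOpen (hA.inter (hN₁.inter hN₂))
        ((hu₁.mono fun w hw => ⟨hw.1, hw.2.1⟩).sub (hu₂.mono fun w hw => ⟨hw.1, hw.2.2⟩))
        (fun w hw => hdA w hw.1) ⟨hzA, hz₁, hz₂⟩).differentiableWithinAt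
    · exact (differentiableAt_of_eqOn_isOpen (hB.inter (hN₁.inter hN₂))
        ((hv₁.mono fun w hw => ⟨hw.1, hw.2.1⟩).sub (hv₂.mono fun w hw => ⟨hw.1, hw.2.2⟩))
        hdB ⟨hzB, hz₁, hz₂⟩).differentiableWithinAt
  obtain ⟨d₁, d₂, hd₁, hd₂, heq⟩ := hsplit d hdhol
  obtain ⟨O₁, hO₁, hXO₁, hdO₁⟩ := hd₁.exists_isOpen
  obtain ⟨O₂, hO₂, hXO₂, hdO₂⟩ := hd₂.exists_isOpen
  obtain ⟨O, hO, hXO, heqO⟩ := mem_nhdsSet_iff_exists.mp heq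
  obtain ⟨M₁, M₂, hM₁, hM₂, hXM₁, hXM₂, hM⟩ := hX₁.exists_isOpen_inter_subset hX₂ hO hXO
  set L₁ := M₁ ∩ (N₁ ∩ O₁) with hL₁
  set L₂ := M₂ ∩ (N₂ ∩ O₂) with hL₂
  have hL₁o : IsOpen L₁ := hM₁.inter (hN₁.inter hO₁)
  have hL₂o : IsOpen L₂ := hM₂.inter (hN₂.inter hO₂)
  have hdL : ∀ z ∈ L₁ ∩ L₂, d z = d₁ z - d₂ z := fun z hz => heqO (hM ⟨hz.1.1, hz.2.1⟩)
  set u : (Fin k → ℂ) → E := fun z => if z ∈ L₁ then u₁ z - d₁ z else u₂ z - d₂ z with hu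
  set v : (Fin k → ℂ) → E := fun z => if z ∈ L₁ then v₁ z - d₁ z else v₂ z - d₂ z with hv
  have hu1 : ∀ z ∈ A ∩ L₁, u z = u₁ z - d₁ z := fun z hz => if_pos hz.2
  have hv1 : ∀ z ∈ B ∩ L₁, v z = v₁ z - d₁ z := fun z hz => if_pos hz.2
  have hu2 : ∀ z ∈ A ∩ L₂, u z = u₂ z - d₂ z := fun z hz => by
    by_cases h : z ∈ L₁
    · rw [hu1 z ⟨hz.1, h⟩]
      have e := hdL z ⟨h, hz.2⟩
      rw [hdA z hz.1] at e
      rw [sub_eq_sub_iff_add_eq_add] at e ⊢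
      rw [e, add_comm]
    · exact if_neg h
  have hv2 : ∀ z ∈ B ∩ L₂, v z = v₂ z - d₂ z := fun z hz => by
    by_cases h : z ∈ L₁
    · rw [hv1 z ⟨hz.1, h⟩]
      have e := hdL z ⟨h, hz.2⟩
      rw [hdB z ⟨hz.1, h.2.1, hz.2.2.1⟩] at e
      rw [sub_eq_sub_iff_add_eq_add] at e ⊢
      rw [e, add_comm]
    · exact if_neg h
  refine ⟨L₁ ∪ L₂, u, v, hL₁o.union hL₂o, ?_, ?_, ?_, ?_⟩
  · exact union_subset_union (fun z hz => ⟨hXM₁ hz, hXN₁ hz, hXO₁ hz⟩)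
      (fun z hz => ⟨hXM₂ hz, hXN₂ hz, hXO₂ hz⟩)
  · rintro z ⟨hzA, hz | hz⟩
    · exact (differentiableAt_of_eqOn_isOpen (hA.inter hL₁o)
        ((hu₁.mono fun w hw => ⟨hw.1, hw.2.2.1⟩).sub (hdO₁.mono fun w hw => hw.2.2.2)) hu1
        ⟨hzA, hz⟩).differentiableWithinAt
    · exact (differentiableAt_of_eqOn_isOpen (hA.inter hL₂o)
        ((hu₂.mono fun w hw => ⟨hw.1, hw.2.2.1⟩).sub (hdO₂.mono fun w hw => hw.2.2.2)) hu2
        ⟨hzA, hz⟩).differentiableWithinAt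
  · rintro z ⟨hzA, hz | hz⟩
    · exact (differentiableAt_of_eqOn_isOpen (hB.inter hL₁o)
        ((hv₁.mono fun w hw => ⟨hw.1, hw.2.2.1⟩).sub (hdO₁.mono fun w hw => hw.2.2.2)) hv1
        ⟨hzA, hz⟩).differentiableWithinAt
    · exact (differentiableAt_of_eqOn_isOpen (hB.inter hL₂o)
        ((hv₂.mono fun w hw => ⟨hw.1, hw.2.2.1⟩).sub (hdO₂.mono fun w hw => hw.2.2.2)) hv2
        ⟨hzA, hz⟩).differentiableWithinAt
  · rintro z ⟨⟨hzA, hzB⟩, hz | hz⟩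
    · rw [hu1 z ⟨hzA, hz⟩, hv1 z ⟨hzB, hz⟩, sub_sub_sub_cancel_right]
      exact hs₁ z ⟨⟨hzA, hzB⟩, hz.2.1⟩
    · rw [hu2 z ⟨hzA, hz⟩, hv2 z ⟨hzB, hz⟩, sub_sub_sub_cancel_right]
      exact hs₂ z ⟨⟨hzA, hzB⟩, hz.2.1⟩

theorem cousinSolvable_of_subset_left {A B X : Set (Fin k → ℂ)} {s : (Fin k → ℂ) → E}
    (hA : IsOpen A) (hs : DifferentiableOn ℂ s (A ∩ B)) (hX : X ⊆ A) : CousinSolvable A B s X :=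
  ⟨A, 0, -s, hA, hX, differentiableOn_const 0, by
    rw [inter_comm]; exact hs.neg, fun z _ => by simp⟩

theorem cousinSolvable_of_subset_right {A B X : Set (Fin k → ℂ)} {s : (Fin k → ℂ) → E}
    (hB : IsOpen B) (hs : DifferentiableOn ℂ s (A ∩ B)) (hX : X ⊆ B) : CousinSolvable A B s X :=
  ⟨B, s, 0, hB, hX, hs, differentiableOn_const 0, fun z _ => by simp⟩

theorem realBox_inter_update {a b : Fin k × Bool → ℝ} {i : Fin k × Bool} {t : ℝ}
    (ht : t ∈ Icc (a i) (b i)) :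
    realBox a (Function.update b i t) ∩ realBox (Function.update a i t) b =
      realBox (Function.update a i t) (Function.update b i t) := by
  ext z
  constructor
  · rintro ⟨h1, h2⟩ l
    exact ⟨(h2 l).1, (h1 l).2⟩
  · intro h
    refine ⟨fun l => ⟨?_, (h l).2⟩, fun l => ⟨(h l).1, ?_⟩⟩
    · have := (h l).1
      by_cases hl : l = i
      · subst hl; simp only [Function.update_self] at this; exact ht.1.trans this
      · rwa [Function.update_of_ne hl] at this
    · have := (h l).2
      by_cases hl : l = i
      · subst hl; simp only [Function.update_self] at this; exact this.trans ht.2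
      · rwa [Function.update_of_ne hl] at this

theorem realBox_subset_union_update (a b : Fin k × Bool → ℝ) (i : Fin k × Bool) (t : ℝ) :
    realBox a b ⊆ realBox a (Function.update b i t) ∪ realBox (Function.update a i t) b := by
  intro z hz
  rcases le_total (realCoord i z) t with h | h
  · refine .inl fun l => ⟨(hz l).1, ?_⟩
    by_cases hl : l = i
    · subst hl; simpa using h
    · rw [Function.update_of_ne hl]; exact (hz l).2
  · refine .inr fun l => ⟨?_, (hz l).2⟩
    by_cases hl : l = i
    · subst hl; simpa using h
    · rw [Function.update_of_ne hl]; exact (hz l).1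

theorem realBox_update_subset_left {a b : Fin k × Bool → ℝ} {i : Fin k × Bool} {t : ℝ}
    (ht : t ≤ b i) : realBox a (Function.update b i t) ⊆ realBox a b := by
  intro z hz l
  refine ⟨(hz l).1, ?_⟩
  have := (hz l).2
  by_cases hl : l = i
  · subst hl; simp only [Function.update_self] at this; exact this.trans ht
  · rwa [Function.update_of_ne hl] at this

theorem realBox_update_subset_right {a b : Fin k × Bool → ℝ} {i : Fin k × Bool} {t : ℝ}
    (ht : a i ≤ t) : realBox (Function.update a i t) b ⊆ realBox a b := by
  intro z hz l
  refine ⟨?_, (hz l).2⟩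
  have := (hz l).1
  by_cases hl : l = i
  · subst hl; simp only [Function.update_self] at this; exact ht.trans this
  · rwa [Function.update_of_ne hl] at this

/-- Additive Cousin problem for a cover by two open sets. -/
theorem SplitsOn.cousinSolvable [CompleteSpace E] {Y : Set (Fin k → ℂ)} (hS : SplitsOn Y)
    (hY : IsClosed Y) {A B : Set (Fin k → ℂ)} (hA : IsOpen A) (hB : IsOpen B)
    {s : (Fin k → ℂ) → E} (hs : DifferentiableOn ℂ s (A ∩ B)) (a b : Fin k × Bool → ℝ)
    (hcov : Y ∩ realBox a b ⊆ A ∪ B) : CousinSolvable A B s (Y ∩ realBox a b) := by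
  have hcpt : ∀ a b, IsCompact (Y ∩ realBox a b) := fun a b =>
    (isCompact_realBox a b).inter_left hY
  obtain ⟨δ₀, hδ₀, hleb⟩ : ∃ δ > 0, ∀ x ∈ Y ∩ realBox a b, ball x δ ⊆ A ∨ ball x δ ⊆ B := by
    obtain ⟨δ, hδ, h⟩ := lebesgue_number_lemma_of_metric (hcpt a b)
      (c := fun i : Bool => if i then A else B) (by rintro (_ | _) <;> simpa)
      (fun z hz => by
        rcases hcov hz with h | h
        · exact mem_iUnion.mpr ⟨true, by simpa using h⟩
        · exact mem_iUnion.mpr ⟨false, by simpa using h⟩)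
    refine ⟨δ, hδ, fun x hx => ?_⟩
    obtain ⟨_ | _, h⟩ := h x hx
    · exact .inr (by simpa using h)
    · exact .inl (by simpa using h)
  set δ := δ₀ / 3 with hδ
  have hδ' : 0 < δ := by positivity
  clear hcov
  induction hn : ∑ i, ⌈(b i - a i) / δ⌉₊ using Nat.strong_induction_on generalizing a b with
  | _ n ih =>
  by_cases hsmall : ∀ i, b i - a i ≤ δ
  · rcases (Y ∩ realBox a b).eq_empty_or_nonempty with h | ⟨x, hx⟩
    · rw [h]; exact cousinSolvable_of_subset_left hA hs (empty_subset _)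
    have hsub : Y ∩ realBox a b ⊆ ball x δ₀ := by
      intro z hz
      rw [mem_ball, dist_eq_norm]
      refine (norm_sub_le_of_realCoord hδ'.le fun i => ?_).trans_lt (by linarith : 2 * δ < δ₀)
      exact (abs_sub_le_of_le_of_le (hz.2 i).1 (hz.2 i).2 (hx.2 i).1 (hx.2 i).2).trans (hsmall i)
    rcases hleb x hx with h | h
    · exact cousinSolvable_of_subset_left hA hs (hsub.trans h)
    · exact cousinSolvable_of_subset_right hB hs (hsub.trans h)
  · push Not at hsmall
    obtain ⟨i, hi⟩ := hsmall
    set t := a i + δ with ht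
    have hti : t ∈ Icc (a i) (b i) := ⟨by linarith, by linarith⟩
    have hgt : 1 < (b i - a i) / δ := by rwa [lt_div_iff₀ hδ', one_mul]
    have hsum : ∀ a' b' : Fin k × Bool → ℝ, (∀ l ≠ i, b' l - a' l = b l - a l) →
        ⌈(b' i - a' i) / δ⌉₊ < ⌈(b i - a i) / δ⌉₊ →
        ∑ i, ⌈(b' i - a' i) / δ⌉₊ < n := by
      intro a' b' h1 h2
      rw [← hn]
      refine Finset.sum_lt_sum (fun l _ => ?_) ⟨i, Finset.mem_univ i, h2⟩
      by_cases hl : l = i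
      · subst hl; exact h2.le
      · rw [h1 l hl]
    have hl := realBox_update_subset_left (a := a) hti.2
    have hr := realBox_update_subset_right (b := b) hti.1
    have h1 := ih _ (hsum a (Function.update b i t)
      (fun l hl => by rw [Function.update_of_ne hl]) (by
        have : (Function.update b i t i - a i) / δ = 1 := by
          rw [Function.update_self, ht]; field_simp; ring
        rw [this, Nat.ceil_one, Nat.lt_ceil]
        exact_mod_cast hgt)) a (Function.update b i t)
      (fun x hx => hleb x ⟨hx.1, hl hx.2⟩) rfl
    have h2 := ih _ (hsum (Function.update a i t) b
      (fun l hl => by rw [Function.update_of_ne hl]) (by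
        have : (b i - Function.update a i t i) / δ = (b i - a i) / δ - 1 := by
          rw [Function.update_self, ht]; field_simp; ring
        rw [this, Nat.ceil_sub_one]
        exact Nat.sub_lt (Nat.ceil_pos.mpr (by linarith)) one_pos)) (Function.update a i t) b
      (fun x hx => hleb x ⟨hx.1, hr hx.2⟩) rfl
    have hint : Y ∩ realBox a (Function.update b i t) ∩ (Y ∩ realBox (Function.update a i t) b) =
        Y ∩ realBox (Function.update a i t) (Function.update b i t) := by
      rw [← inter_inter_distrib_left, realBox_inter_update hti]
    refine (CousinSolvable.union hA hB (hcpt _ _) (hcpt _ _) ?_ ?_ h1 h2).mono ?_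
    · rintro x ⟨hx, -⟩
      rcases hleb x ⟨hx.1, hl hx.2⟩ with h | h
      · exact .inl (h (mem_ball_self hδ₀))
      · exact .inr (h (mem_ball_self hδ₀))
    · rw [hint]
      exact hS E a b i t hti
    · rw [← inter_union_distrib_left]
      exact inter_subset_inter_right _ (realBox_subset_union_update a b i t)

end Cousin

section SequenceSpace

theorem differentiableAt_resolvent_clm {F : Type*} [NormedAddCommGroup F] [NormedSpace ℂ F]
    [CompleteSpace F] {T : F →L[ℂ] F} {c : ℂ} (hc : c ∈ resolventSet ℂ T) :
    DifferentiableAt ℂ (fun c => resolvent T c) c :=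
  (spectrum.hasDerivAt_resolvent_const_left hc).differentiableAt

open scoped BoundedContinuousFunction

variable {E : Type*} [NormedAddCommGroup E] [NormedSpace ℂ E]

/-- The right shift on bounded sequences. -/
noncomputable def seqShift : (ℕ →ᵇ E) →L[ℂ] (ℕ →ᵇ E) :=
  LinearMap.mkContinuous
    { toFun := fun a => BoundedContinuousFunction.ofNormedAddCommGroupDiscrete
        (fun n => Nat.casesOn n 0 fun m => a m) ‖a‖ (by
          rintro (_ | n)
          · simp
          · exact a.norm_coe_le_norm n)
      map_add' := fun a b => by ext (_ | n) <;> simp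
      map_smul' := fun c a => by ext (_ | n) <;> simp } 1 fun a => by
    rw [one_mul]
    refine (BoundedContinuousFunction.norm_le (norm_nonneg a)).mpr ?_
    rintro (_ | n)
    · simp
    · exact a.norm_coe_le_norm n

@[simp] theorem seqShift_zero (a : ℕ →ᵇ E) : seqShift a 0 = 0 := rfl

@[simp] theorem seqShift_succ (a : ℕ →ᵇ E) (n : ℕ) : seqShift a (n + 1) = a n := rfl

theorem norm_seqShift_le : ‖(seqShift : (ℕ →ᵇ E) →L[ℂ] (ℕ →ᵇ E))‖ ≤ 1 :=
  LinearMap.mkContinuous_norm_le _ zero_le_one _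

/-- The sequence `(e, 0, 0, …)`. -/
noncomputable def seqConst : E →L[ℂ] (ℕ →ᵇ E) :=
  LinearMap.mkContinuous
    { toFun := fun e => BoundedContinuousFunction.ofNormedAddCommGroupDiscrete
        (fun n => Nat.casesOn n e fun _ => 0) ‖e‖ (by rintro (_ | n) <;> simp)
      map_add' := fun a b => by ext (_ | n) <;> simp
      map_smul' := fun c a => by ext (_ | n) <;> simp } 1 fun e => by
    rw [one_mul]
    refine (BoundedContinuousFunction.norm_le (norm_nonneg e)).mpr ?_
    rintro (_ | n) <;> simp

@[simp] theorem seqConst_zero (e : E) : seqConst e 0 = e := rfl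

@[simp] theorem seqConst_succ (e : E) (n : ℕ) : seqConst e (n + 1) = 0 := rfl

/-- Evaluation at `w` of the power series whose coefficients form a bounded sequence. -/
noncomputable def seqEval (w : ℂ) : (ℕ →ᵇ E) →L[ℂ] E :=
  ∑' n : ℕ, w ^ n • BoundedContinuousFunction.evalCLM ℂ n

theorem norm_evalCLM_le (n : ℕ) :
    ‖(BoundedContinuousFunction.evalCLM ℂ n : (ℕ →ᵇ E) →L[ℂ] E)‖ ≤ 1 :=
  ContinuousLinearMap.opNorm_le_bound _ zero_le_one fun a => by
    simpa using a.norm_coe_le_norm n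

theorem norm_pow_smul_evalCLM_le (w : ℂ) (n : ℕ) :
    ‖w ^ n • (BoundedContinuousFunction.evalCLM ℂ n : (ℕ →ᵇ E) →L[ℂ] E)‖ ≤ ‖w‖ ^ n := by
  rw [norm_smul, norm_pow]
  exact mul_le_of_le_one_right (by positivity) (norm_evalCLM_le n)

variable [CompleteSpace E]

theorem hasSum_seqEval {w : ℂ} (hw : ‖w‖ < 1) (a : ℕ →ᵇ E) :
    HasSum (fun n => w ^ n • a n) (seqEval w a) := by
  have hs : Summable fun n : ℕ => w ^ n • (BoundedContinuousFunction.evalCLM ℂ n :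
      (ℕ →ᵇ E) →L[ℂ] E) :=
    Summable.of_norm_bounded (summable_geometric_of_lt_one (norm_nonneg w) hw)
      (norm_pow_smul_evalCLM_le w)
  simpa [seqEval] using! hs.hasSum.mapL (ContinuousLinearMap.apply ℂ E a)

theorem seqEval_const {w : ℂ} (hw : ‖w‖ < 1) (e : E) : seqEval w (seqConst e) = e := by
  refine (hasSum_seqEval hw (seqConst e)).unique ?_
  convert hasSum_single (f := fun n => w ^ n • seqConst e n) 0 ?_ using 1
  · simp
  · rintro (_ | n) h
    · exact absurd rfl h
    · simp

theorem seqEval_shift {w : ℂ} (hw : ‖w‖ < 1) (a : ℕ →ᵇ E) :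
    seqEval w (seqShift a) = w • seqEval w a := by
  refine (hasSum_seqEval hw (seqShift a)).unique ?_
  rw [← hasSum_nat_add_iff' 1]
  simpa [pow_succ', mul_smul] using (hasSum_seqEval hw a).const_smul w

theorem differentiableAt_seqEval {w : ℂ} (hw : ‖w‖ < 1) :
    DifferentiableAt ℂ (seqEval : ℂ → (ℕ →ᵇ E) →L[ℂ] E) w := by
  obtain ⟨r, hwr, hr⟩ := exists_between hw
  have hr0 : 0 ≤ r := (norm_nonneg w).trans hwr.le
  have : DifferentiableOn ℂ (fun w : ℂ => ∑' n : ℕ, w ^ n •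
      (BoundedContinuousFunction.evalCLM ℂ n : (ℕ →ᵇ E) →L[ℂ] E)) (ball 0 r) := by
    refine Complex.differentiableOn_tsum_of_summable_norm (summable_geometric_of_lt_one hr0 hr)
      (fun n => by fun_prop) isOpen_ball fun n z hz => ?_
    refine (norm_pow_smul_evalCLM_le z n).trans ?_
    gcongr
    simpa using (mem_ball_zero_iff.mp hz).le
  exact this.differentiableAt (isOpen_ball.mem_nhds (by simpa using hwr))

theorem norm_seqEval_sub_sum_le {w : ℂ} {r : ℝ} (hr : r < 1) (hw : ‖w‖ ≤ r) (a : ℕ →ᵇ E) (n : ℕ) :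
    ‖seqEval w a - ∑ m ∈ Finset.range n, w ^ m • a m‖ ≤ ‖a‖ * r ^ n / (1 - r) := by
  rw [norm_sub_rev]
  refine norm_sub_le_of_geometric_bound_of_hasSum hr (fun m => ?_)
    (hasSum_seqEval (hw.trans_lt hr) a) n
  rw [norm_smul, norm_pow, mul_comm]
  gcongr
  exact a.norm_coe_le_norm m

theorem norm_seqEval_le {w : ℂ} {r : ℝ} (hr : r < 1) (hw : ‖w‖ ≤ r) (a : ℕ →ᵇ E) :
    ‖seqEval w a‖ ≤ ‖a‖ / (1 - r) := by
  simpa using norm_seqEval_sub_sum_le hr hw a 0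

theorem mem_resolventSet_seqShift {c : ℂ} (hc : 1 < ‖c‖) :
    c ∈ resolventSet ℂ (seqShift : (ℕ →ᵇ E) →L[ℂ] (ℕ →ᵇ E)) := by
  refine spectrum.mem_resolventSet_of_norm_lt_mul (lt_of_le_of_lt ?_ hc)
  exact mul_le_one₀ norm_seqShift_le (norm_nonneg _) ContinuousLinearMap.norm_id_le

theorem differentiableAt_resolvent_seqShift {c : ℂ} (hc : 1 < ‖c‖) :
    DifferentiableAt ℂ (fun c => resolvent (seqShift : (ℕ →ᵇ E) →L[ℂ] (ℕ →ᵇ E)) c) c :=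
  differentiableAt_resolvent_clm (mem_resolventSet_seqShift hc)

theorem seqShift_sub_resolvent {c : ℂ} (hc : 1 < ‖c‖) (a : ℕ →ᵇ E) :
    seqShift (resolvent (seqShift : (ℕ →ᵇ E) →L[ℂ] (ℕ →ᵇ E)) c a) -
      c • resolvent (seqShift : (ℕ →ᵇ E) →L[ℂ] (ℕ →ᵇ E)) c a = -a := by
  have h := Ring.mul_inverse_cancel _ (mem_resolventSet_seqShift (E := E) hc)
  have h' := congrArg (fun T : (ℕ →ᵇ E) →L[ℂ] (ℕ →ᵇ E) => T a) h
  simp only [mul_apply_eq_comp, one_apply_eq_self] at h'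
  rw [← neg_sub, neg_inj]
  simpa [resolvent, Algebra.algebraMap_eq_smul_one] using h'

end SequenceSpace

section Extension

open scoped BoundedContinuousFunction

variable {k : ℕ} {E : Type} [NormedAddCommGroup E] [NormedSpace ℂ E] [CompleteSpace E]

open Classical in
/-- Oka's extension from the graph of `q`, with the extra variable encoded by power series
coefficients. -/
theorem SplitsOn.exists_extension {Y : Set (Fin k → ℂ)} (hS : SplitsOn Y) (hY : IsClosed Y)
    {q : (Fin k → ℂ) → ℂ} (hq : Differentiable ℂ q) (a b : Fin k × Bool → ℝ)
    {g : (Fin k → ℂ) → E} (hg : HolNear ((Y ∩ {z | ‖q z‖ ≤ 1}) ∩ realBox a b) g) :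
    ∃ ρ : ℝ, 1 < ρ ∧ ∃ G : (Fin k → ℂ) → (ℕ →ᵇ E), HolNear (Y ∩ realBox a b) G ∧
      ∀ᶠ z in 𝓝ˢ ((Y ∩ {z | ‖q z‖ ≤ 1}) ∩ realBox a b), g z = seqEval (q z / ρ) (G z) := by
  obtain ⟨A, hA, hYA, hgA⟩ := hg.exists_isOpen
  obtain ⟨ρ, hρ, hρA⟩ : ∃ ρ : ℝ, 1 < ρ ∧ ∀ z ∈ Y ∩ realBox a b, ‖q z‖ ≤ ρ → z ∈ A := by
    have hcpt : IsCompact ((Y ∩ realBox a b) \ A) :=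
      ((isCompact_realBox a b).inter_left hY).diff hA
    rcases ((Y ∩ realBox a b) \ A).eq_empty_or_nonempty with h | h
    · exact ⟨2, one_lt_two, fun z hz _ => by
        by_contra hzA
        exact (h ▸ (⟨hz, hzA⟩ : z ∈ (Y ∩ realBox a b) \ A) : z ∈ (∅ : Set _))⟩
    · obtain ⟨z₀, hz₀, hmin⟩ := hcpt.exists_isMinOn h hq.continuous.norm.continuousOn
      have h1 : 1 < ‖q z₀‖ := by
        by_contra! hle
        exact hz₀.2 (hYA ⟨⟨hz₀.1.1, hle⟩, hz₀.1.2⟩)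
      refine ⟨(1 + ‖q z₀‖) / 2, by linarith, fun z hz hzq => ?_⟩
      by_contra hzA
      have := hmin (⟨hz, hzA⟩ : z ∈ (Y ∩ realBox a b) \ A)
      simp only [mem_ofPred_eq] at this
      linarith
  have hρ0 : 0 < ρ := by linarith
  set B : Set (Fin k → ℂ) := {z | ρ < ‖q z‖} with hB
  have hBo : IsOpen B := isOpen_lt continuous_const hq.continuous.norm
  set c : (Fin k → ℂ) → ℂ := fun z => q z / ρ with hc
  have hcd : Differentiable ℂ c := by
    simp only [hc, div_eq_mul_inv]; exact hq.mul_const _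
  have hcn : ∀ z, ‖c z‖ = ‖q z‖ / ρ := fun z => by simp [hc, abs_of_pos hρ0]
  have hcB : ∀ z ∈ B, 1 < ‖c z‖ := fun z hz => by rw [hcn, lt_div_iff₀ hρ0, one_mul]; exact hz
  set T : (ℕ →ᵇ E) →L[ℂ] (ℕ →ᵇ E) := seqShift with hT
  set s : (Fin k → ℂ) → (ℕ →ᵇ E) := fun z => resolvent T (c z) (seqConst (g z)) with hs
  have hsd : DifferentiableOn ℂ s (A ∩ B) := by
    rintro z ⟨hzA, hzB⟩
    have h1 : DifferentiableAt ℂ (fun z => resolvent T (c z)) z :=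
      DifferentiableAt.comp (g := fun c => resolvent T c) (f := c) z
        (differentiableAt_resolvent_seqShift (hcB z hzB)) hcd.differentiableAt
    have h2 : DifferentiableAt ℂ (fun z => (seqConst (g z) : ℕ →ᵇ E)) z :=
      seqConst.differentiableAt.comp z (hgA.differentiableAt (hA.mem_nhds hzA))
    exact (h1.clm_apply h2).differentiableWithinAt
  obtain ⟨N, u, v, hN, hYN, hu, hv, huv⟩ := hS.cousinSolvable hY hA hBo hsd a b fun z hz => by
    by_cases h : ‖q z‖ ≤ ρ
    · exact .inl (hρA z hz h)
    · exact .inr (not_le.mp h)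
  set G : (Fin k → ℂ) → (ℕ →ᵇ E) := fun z =>
    if z ∈ A then seqConst (g z) + (T (u z) - c z • u z) else T (v z) - c z • v z with hG
  have hGA : ∀ z ∈ A ∩ N, G z = seqConst (g z) + (T (u z) - c z • u z) := fun z hz => if_pos hz.1
  have hGB : ∀ z ∈ B ∩ N, G z = T (v z) - c z • v z := by
    rintro z ⟨hzB, hzN⟩
    by_cases hzA : z ∈ A
    · rw [hGA z ⟨hzA, hzN⟩]
      have e : u z = s z + v z := by rw [← huv z ⟨⟨hzA, hzB⟩, hzN⟩]; abel
      have e2 := seqShift_sub_resolvent (hcB z hzB) (seqConst (g z))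
      rw [e, map_add, smul_add]
      rw [sub_eq_iff_eq_add] at e2
      simp only [hs, hT]
      rw [e2]
      abel
    · exact if_neg hzA
  refine ⟨ρ, hρ, G, ?_, ?_⟩
  · refine HolNear.of_isOpen ((hA.union hBo).inter hN) (fun z hz => ⟨?_, hYN hz⟩) ?_
    · by_cases h : ‖q z‖ ≤ ρ
      · exact .inl (hρA z hz h)
      · exact .inr (not_le.mp h)
    · rintro z ⟨hzA | hzB, hzN⟩
      · refine (differentiableAt_of_eqOn_isOpen (hA.inter hN) ?_ hGA
          ⟨hzA, hzN⟩).differentiableWithinAt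
        exact (seqConst.differentiable.comp_differentiableOn (hgA.mono inter_subset_left)).add
          ((T.differentiable.comp_differentiableOn hu).sub (hcd.differentiableOn.smul hu))
      · refine (differentiableAt_of_eqOn_isOpen (hBo.inter hN) ?_ hGB
          ⟨hzB, hzN⟩).differentiableWithinAt
        exact (T.differentiable.comp_differentiableOn hv).sub (hcd.differentiableOn.smul hv)
  · refine mem_nhdsSet_iff_exists.mpr ⟨(A ∩ N) ∩ {z | ‖q z‖ < ρ},
      (hA.inter hN).inter (isOpen_lt hq.continuous.norm continuous_const), ?_, ?_⟩
    · rintro z ⟨⟨hzY, hzq⟩, hzb⟩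
      exact ⟨⟨hYA ⟨⟨hzY, hzq⟩, hzb⟩, hYN ⟨hzY, hzb⟩⟩, lt_of_le_of_lt hzq hρ⟩
    · rintro z ⟨hz, hzq⟩
      have hw : ‖c z‖ < 1 := by rw [hcn, div_lt_one hρ0]; exact hzq
      show g z = seqEval (c z) (G z)
      rw [hGA z hz, map_add, map_sub, seqEval_const hw, hT, seqEval_shift hw, map_smul, sub_self,
        add_zero]

theorem SplitsOn.inter_norm_le {Y : Set (Fin k → ℂ)} (hS : SplitsOn Y) (hY : IsClosed Y)
    {q : (Fin k → ℂ) → ℂ} (hq : Differentiable ℂ q) : SplitsOn (Y ∩ {z | ‖q z‖ ≤ 1}) := by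
  intro E _ _ _ a b i t ht d hd
  obtain ⟨ρ, hρ, G, hG, hdG⟩ := hS.exists_extension hY hq _ _ hd
  obtain ⟨G₁, G₂, hG₁, hG₂, hGe⟩ := hS _ a b i t ht G hG
  have hρ0 : 0 < ρ := by linarith
  have key : ∀ (X : Set (Fin k → ℂ)) (F : (Fin k → ℂ) → (ℕ →ᵇ E)), HolNear (Y ∩ X) F →
      HolNear ((Y ∩ {z | ‖q z‖ ≤ 1}) ∩ X) (fun z => seqEval (q z / ρ) (F z)) := by
    intro X F hF
    obtain ⟨O, hO, hXO, hFO⟩ := hF.exists_isOpen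
    refine HolNear.of_isOpen (hO.inter (isOpen_lt hq.continuous.norm
      (continuous_const (y := ρ)))) ?_ ?_
    · rintro z ⟨⟨hzY, hzq⟩, hzX⟩
      exact ⟨hXO ⟨hzY, hzX⟩, lt_of_le_of_lt hzq hρ⟩
    · rintro z ⟨hzO, hzq⟩
      have hw : ‖q z / ρ‖ < 1 := by
        simpa [abs_of_pos hρ0, div_lt_one hρ0] using hzq
      have h1 : DifferentiableAt ℂ (fun z => (seqEval (q z / ρ) : (ℕ →ᵇ E) →L[ℂ] E)) z :=
        DifferentiableAt.comp (g := seqEval) (f := fun z => q z / ρ) z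
          (differentiableAt_seqEval hw) (by simp only [div_eq_mul_inv]; exact (hq z).mul_const _)
      exact (h1.clm_apply (hFO.differentiableAt (hO.mem_nhds hzO))).differentiableWithinAt
  refine ⟨_, _, key _ G₁ hG₁, key _ G₂ hG₂, ?_⟩
  have hmono : 𝓝ˢ ((Y ∩ {z | ‖q z‖ ≤ 1}) ∩
      realBox (Function.update a i t) (Function.update b i t)) ≤
      𝓝ˢ (Y ∩ realBox (Function.update a i t) (Function.update b i t)) :=
    nhdsSet_mono (inter_subset_inter_left _ inter_subset_left)
  filter_upwards [hdG, hmono hGe] with z h1 h2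
  rw [h1, h2, map_sub]

end Extension

section Approximation

open scoped BoundedContinuousFunction

variable {k : ℕ} {E : Type} [NormedAddCommGroup E] [NormedSpace ℂ E]

/-- Polynomial maps `ℂ^k → E`. -/
def polyMaps (k : ℕ) (E : Type) [NormedAddCommGroup E] [NormedSpace ℂ E] :
    Submodule ℂ ((Fin k → ℂ) → E) :=
  Submodule.span ℂ {h | ∃ (p : MvPolynomial (Fin k) ℂ) (e : E),
    h = fun z => MvPolynomial.eval z p • e}

theorem smul_mem_polyMaps (p : MvPolynomial (Fin k) ℂ) (e : E) :
    (fun z => MvPolynomial.eval z p • e) ∈ polyMaps k E :=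
  Submodule.subset_span ⟨p, e, rfl⟩

theorem mul_mem_polyMaps (p : MvPolynomial (Fin k) ℂ) {P : (Fin k → ℂ) → E}
    (hP : P ∈ polyMaps k E) : (fun z => MvPolynomial.eval z p • P z) ∈ polyMaps k E := by
  induction hP using Submodule.span_induction with
  | mem h hh =>
    obtain ⟨q, e, rfl⟩ := hh
    convert smul_mem_polyMaps (p * q) e using 2 with z
    rw [map_mul, mul_smul]
  | zero =>
    convert (polyMaps k E).zero_mem using 1
    ext z
    simp
  | add x y _ _ hx hy => simpa [smul_add] using! (polyMaps k E).add_mem hx hy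
  | smul c x _ hx =>
    convert (polyMaps k E).smul_mem c hx using 1
    ext z
    simp [smul_comm c]

theorem exists_polynomial_of_mem_polyMaps {P : (Fin k → ℂ) → ℂ} (hP : P ∈ polyMaps k ℂ) :
    ∃ p : MvPolynomial (Fin k) ℂ, ∀ z, P z = MvPolynomial.eval z p := by
  induction hP using Submodule.span_induction with
  | mem h hh =>
    obtain ⟨q, e, rfl⟩ := hh
    exact ⟨q * MvPolynomial.C e, fun z => by simp⟩
  | zero => exact ⟨0, fun z => by simp⟩
  | add x y _ _ hx hy =>
    obtain ⟨p, hp⟩ := hx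
    obtain ⟨q, hq⟩ := hy
    exact ⟨p + q, fun z => by simp [hp, hq]⟩
  | smul c x _ hx =>
    obtain ⟨p, hp⟩ := hx
    exact ⟨MvPolynomial.C c * p, fun z => by simp [hp]⟩

/-- Uniform approximability on `S` by polynomial maps. -/
def PolyApproxOn (S : Set (Fin k → ℂ)) (g : (Fin k → ℂ) → E) : Prop :=
  ∀ ε > 0, ∃ P ∈ polyMaps k E, ∀ z ∈ S, ‖g z - P z‖ ≤ ε

theorem PolyApproxOn.of_forall {S : Set (Fin k → ℂ)} {g : (Fin k → ℂ) → E}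
    (h : ∀ ε > 0, ∃ g', PolyApproxOn S g' ∧ ∀ z ∈ S, ‖g z - g' z‖ ≤ ε) : PolyApproxOn S g := by
  intro ε hε
  obtain ⟨g', hg', hgg'⟩ := h (ε / 2) (by positivity)
  obtain ⟨P, hP, hPg⟩ := hg' (ε / 2) (by positivity)
  refine ⟨P, hP, fun z hz => ?_⟩
  have := norm_add_le (g z - g' z) (g' z - P z)
  rw [sub_add_sub_cancel] at this
  linarith [hgg' z hz, hPg z hz]

theorem PolyApproxOn.of_mem {S : Set (Fin k → ℂ)} {P : (Fin k → ℂ) → E}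
    (hP : P ∈ polyMaps k E) : PolyApproxOn S P :=
  fun ε hε => ⟨P, hP, fun z _ => by simpa using hε.le⟩

theorem PolyApproxOn.add {S : Set (Fin k → ℂ)} {g g' : (Fin k → ℂ) → E}
    (hg : PolyApproxOn S g) (hg' : PolyApproxOn S g') : PolyApproxOn S (fun z => g z + g' z) := by
  intro ε hε
  obtain ⟨P, hP, h⟩ := hg (ε / 2) (by positivity)
  obtain ⟨P', hP', h'⟩ := hg' (ε / 2) (by positivity)
  refine ⟨P + P', (polyMaps k E).add_mem hP hP', fun z hz => ?_⟩
  rw [Pi.add_apply, add_sub_add_comm]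
  refine (norm_add_le _ _).trans ?_
  linarith [h z hz, h' z hz]

theorem PolyApproxOn.sum {ι : Type*} {S : Set (Fin k → ℂ)} (s : Finset ι)
    {g : ι → (Fin k → ℂ) → E} (hg : ∀ i ∈ s, PolyApproxOn S (g i)) :
    PolyApproxOn S (fun z => ∑ i ∈ s, g i z) := by
  classical
  induction s using Finset.induction_on with
  | empty => simpa using! PolyApproxOn.of_mem (polyMaps k E).zero_mem
  | insert i s hi ih =>
    simp only [Finset.sum_insert hi]
    exact (hg i (Finset.mem_insert_self i s)).add
      (ih fun j hj => hg j (Finset.mem_insert_of_mem hj))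

theorem exists_norm_eval_le {S : Set (Fin k → ℂ)} (hS : Bornology.IsBounded S)
    (p : MvPolynomial (Fin k) ℂ) : ∃ M > 0, ∀ z ∈ S, ‖MvPolynomial.eval z p‖ ≤ M := by
  have hc : IsCompact (closure S) := hS.isCompact_closure
  obtain ⟨M, hM⟩ := hc.exists_bound_of_continuousOn
    (f := fun z => MvPolynomial.eval z p) (MvPolynomial.continuous_eval p).continuousOn
  exact ⟨max M 1, by positivity, fun z hz => (hM z (subset_closure hz)).trans (le_max_left _ _)⟩

theorem PolyApproxOn.polynomial_smul {S : Set (Fin k → ℂ)} (hS : Bornology.IsBounded S)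
    {g : (Fin k → ℂ) → E} (hg : PolyApproxOn S g) (p : MvPolynomial (Fin k) ℂ) :
    PolyApproxOn S (fun z => MvPolynomial.eval z p • g z) := by
  obtain ⟨M, hM0, hM⟩ := exists_norm_eval_le hS p
  intro ε hε
  obtain ⟨P, hP, h⟩ := hg (ε / M) (by positivity)
  refine ⟨_, mul_mem_polyMaps p hP, fun z hz => ?_⟩
  rw [← smul_sub, norm_smul]
  calc _ ≤ M * (ε / M) := mul_le_mul (hM z hz) (h z hz) (norm_nonneg _) hM0.le
    _ = ε := by field_simp

theorem coeff_cauchyPowerSeries (f : ℂ → E) (c : ℂ) (R : ℝ) (n : ℕ) :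
    (cauchyPowerSeries f c R).coeff n =
      (2 * Real.pi * Complex.I : ℂ)⁻¹ • ∮ z in C(c, R), (1 / (z - c)) ^ n • (z - c)⁻¹ • f z :=
  cauchyPowerSeries_apply f c R n 1

theorem differentiableAt_circleIntegral_update [CompleteSpace E] {R r : ℝ} (hr : 0 < r)
    (hrR : r < R) {g : (Fin k → ℂ) → E} (hg : DifferentiableOn ℂ g (ball 0 R)) (j : Fin k) (n : ℕ)
    {z : Fin k → ℂ} (hz : z ∈ ball 0 R) :
    DifferentiableAt ℂ (fun z => (cauchyPowerSeries (fun ζ => g (Function.update z j ζ)) 0 r).coeff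
      n) z := by
  have hup : Differentiable ℂ fun p : (Fin k → ℂ) × ℂ => Function.update p.1 j p.2 := by
    rw [differentiable_pi]
    intro l
    by_cases h : l = j
    · subst h; simp only [Function.update_self]; exact differentiable_snd
    · simp only [Function.update_of_ne h]; fun_prop
  have hO : IsOpen {p : (Fin k → ℂ) × ℂ | Function.update p.1 j p.2 ∈ ball (0 : Fin k → ℂ) R ∧
      p.2 ≠ 0} := (isOpen_ball.preimage hup.continuous).inter
    (isOpen_ne_fun continuous_snd continuous_const)
  have hF : DifferentiableOn ℂ (fun p : (Fin k → ℂ) × ℂ => (p.2 * Complex.I) • (1 / p.2) ^ n •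
      p.2⁻¹ • g (Function.update p.1 j p.2)) {p : (Fin k → ℂ) × ℂ |
        Function.update p.1 j p.2 ∈ ball (0 : Fin k → ℂ) R ∧ p.2 ≠ 0} := by
    have hg' := hg.comp hup.differentiableOn (t := ball 0 R)
      (s := {p : (Fin k → ℂ) × ℂ | Function.update p.1 j p.2 ∈ ball (0 : Fin k → ℂ) R ∧ p.2 ≠ 0})
      fun p hp => hp.1
    have hi : DifferentiableOn ℂ (fun p : (Fin k → ℂ) × ℂ => p.2⁻¹) {p : (Fin k → ℂ) × ℂ |
        Function.update p.1 j p.2 ∈ ball (0 : Fin k → ℂ) R ∧ p.2 ≠ 0} :=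
      differentiable_snd.differentiableOn.inv fun p hp => hp.2
    have h2 : DifferentiableOn ℂ (fun p : (Fin k → ℂ) × ℂ => (1 / p.2) ^ n) {p : (Fin k → ℂ) × ℂ |
        Function.update p.1 j p.2 ∈ ball (0 : Fin k → ℂ) R ∧ p.2 ≠ 0} := by
      simp only [one_div]; exact hi.pow n
    exact (differentiable_snd.mul_const Complex.I).differentiableOn.smul (h2.smul (hi.smul hg'))
  have := differentiableAt_intervalIntegral_of_holomorphic hO hF
    (continuous_circleMap 0 r) (a := 0) (b := 2 * Real.pi) (x₀ := z) (fun t _ => ⟨?_, ?_⟩)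
  · have h3 := this.const_smul (2 * Real.pi * Complex.I : ℂ)⁻¹
    refine h3.congr_of_eventuallyEq (Eventually.of_forall fun w => ?_)
    simp only [coeff_cauchyPowerSeries]
    simp [circleIntegral, deriv_circleMap]
  · rw [mem_ball_zero_iff, pi_norm_lt_iff (by linarith)]
    intro l
    by_cases h : l = j
    · subst h; simpa [abs_of_pos hr] using hrR
    · rw [Function.update_of_ne h]
      exact (norm_le_pi_norm z l).trans_lt (mem_ball_zero_iff.mp hz)
  · exact circleMap_ne_center (ne_of_gt hr)

/-- Holomorphic functions on a polydisc are limits of polynomials on smaller polydiscs. -/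
theorem polyApproxOn_closedBall [CompleteSpace E] {R : ℝ} {r : ℝ} (hr : 0 < r) (hrR : r < R)
    (s : Finset (Fin k)) {g : (Fin k → ℂ) → E} (hg : DifferentiableOn ℂ g (ball 0 R))
    (hs : ∀ z ∈ ball (0 : Fin k → ℂ) R, ∀ w ∈ ball (0 : Fin k → ℂ) R,
      (∀ l ∈ s, z l = w l) → g z = g w) :
    PolyApproxOn (closedBall 0 r) g := by
  have hR : 0 < R := hr.trans hrR
  induction s using Finset.induction_on generalizing g with
  | empty =>
    intro ε hε
    refine ⟨_, smul_mem_polyMaps 1 (g 0), fun z hz => ?_⟩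
    rw [hs z (closedBall_subset_ball hrR hz) 0 (mem_ball_self hR) (by simp)]
    simpa using hε.le
  | insert j s hj ih =>
    obtain ⟨r', hrr', hr'R⟩ := exists_between hrR
    have hr' : 0 < r' := hr.trans hrr'
    set c : ℕ → (Fin k → ℂ) → E := fun n z =>
      (cauchyPowerSeries (fun ζ => g (Function.update z j ζ)) 0 r').coeff n with hc
    have hcd : ∀ n, DifferentiableOn ℂ (c n) (ball 0 R) := fun n z hz =>
      (differentiableAt_circleIntegral_update hr' hr'R hg j n hz).differentiableWithinAt
    have hup : ∀ z ∈ ball (0 : Fin k → ℂ) R, ∀ ζ : ℂ, ‖ζ‖ < R →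
        Function.update z j ζ ∈ ball (0 : Fin k → ℂ) R := by
      intro z hz ζ hζ
      rw [mem_ball_zero_iff, pi_norm_lt_iff hR]
      intro l
      by_cases h : l = j
      · subst h; simpa using hζ
      · rw [Function.update_of_ne h]
        exact (norm_le_pi_norm z l).trans_lt (mem_ball_zero_iff.mp hz)
    have hcA : ∀ n, PolyApproxOn (closedBall 0 r) (c n) := by
      refine fun n => ih (hcd n) fun z hz w hw hzw => ?_
      simp only [hc, coeff_cauchyPowerSeries]
      congr 1
      refine circleIntegral.integral_congr hr'.le fun ζ hζ => ?_
      have hζ' : ‖ζ‖ < R := by rw [mem_sphere_zero_iff_norm.mp hζ]; exact hr'R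
      rw [hs _ (hup z hz ζ hζ') _ (hup w hw ζ hζ')]
      intro l hl
      by_cases h : l = j
      · subst h; simp
      · rw [Function.update_of_ne h, Function.update_of_ne h]
        exact hzw l ((Finset.mem_insert.mp hl).resolve_left h)
    obtain ⟨M, hM⟩ := (isCompact_closedBall (0 : Fin k → ℂ) r').exists_bound_of_continuousOn
      (hg.continuousOn.mono (closedBall_subset_ball hr'R))
    have hM0 : 0 ≤ M := (norm_nonneg _).trans (hM 0 (mem_closedBall_self hr'.le))
    have hq : r / r' < 1 := (div_lt_one hr').mpr hrr'
    have hq0 : 0 ≤ r / r' := by positivity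
    have hb : ∀ z ∈ closedBall (0 : Fin k → ℂ) r, ∀ n, ‖z j ^ n • c n z‖ ≤ M * (r / r') ^ n := by
      intro z hz n
      have hz' := mem_closedBall_zero_iff.mp hz
      have h1 : ‖c n z‖ ≤ M * (r'⁻¹) ^ n := by
        have h2 : ‖c n z‖ ≤ ‖cauchyPowerSeries (fun ζ => g (Function.update z j ζ)) 0 r' n‖ :=
          FormalMultilinearSeries.norm_apply_eq_norm_coef.ge
        refine h2.trans ((norm_cauchyPowerSeries_le _ _ _ _).trans ?_)
        rw [abs_of_pos hr']
        refine mul_le_mul_of_nonneg_right ?_ (by positivity)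
        have h3 := intervalIntegral.norm_integral_le_of_norm_le_const (a := 0) (b := 2 * Real.pi)
          (f := fun θ => ‖g (Function.update z j (circleMap 0 r' θ))‖) (C := M) (fun θ _ => by
            rw [norm_norm]
            refine hM _ (mem_closedBall_zero_iff.mpr ?_)
            refine (pi_norm_le_iff_of_nonneg hr'.le).mpr fun l => ?_
            by_cases h : l = j
            · subst h; simp [abs_of_pos hr']
            · rw [Function.update_of_ne h]
              exact (norm_le_pi_norm z l).trans (hz'.trans hrr'.le))
        have h4 := (le_abs_self _).trans h3
        rw [sub_zero, abs_of_pos Real.two_pi_pos] at h4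
        calc _ ≤ (2 * Real.pi)⁻¹ * (M * (2 * Real.pi)) := by gcongr
          _ = M := by field_simp
      rw [norm_smul, norm_pow]
      calc ‖z j‖ ^ n * ‖c n z‖ ≤ r ^ n * (M * (r'⁻¹) ^ n) := by
            gcongr
            exact (norm_le_pi_norm z j).trans hz'
        _ = M * (r / r') ^ n := by rw [div_eq_mul_inv, mul_pow]; ring
    have hsum : ∀ z ∈ closedBall (0 : Fin k → ℂ) r, HasSum (fun n => z j ^ n • c n z) (g z) := by
      intro z hz
      have hzR := closedBall_subset_ball hrR hz
      have hz' := mem_closedBall_zero_iff.mp hz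
      have hd1 : Differentiable ℂ fun ζ : ℂ => Function.update z j ζ := by
        rw [differentiable_pi]
        intro l
        by_cases h : l = j
        · subst h; simp only [Function.update_self]; exact differentiable_id
        · simp only [Function.update_of_ne h]; fun_prop
      have hd : DifferentiableOn ℂ (fun ζ => g (Function.update z j ζ)) (ball 0 R) :=
        hg.comp hd1.differentiableOn fun ζ hζ => hup z hzR ζ (mem_ball_zero_iff.mp hζ)
      have hzj : ‖z j‖ < r' := (norm_le_pi_norm z j).trans_lt (hz'.trans_lt hrr')
      have h1 := hasSum_cauchyPowerSeries_integral (f := fun ζ => g (Function.update z j ζ))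
        (c := 0) (R := r') (w := z j) (ContinuousOn.circleIntegrable hr'.le
          (hd.continuousOn.mono (sphere_subset_closedBall.trans (closedBall_subset_ball hr'R)))) hzj
      have h2 := (hd.mono (closedBall_subset_ball hr'R)).diffContOnCl_ball subset_rfl
      rw [zero_add, h2.two_pi_i_inv_smul_circleIntegral_sub_inv_smul
        (mem_ball_zero_iff.mpr hzj), Function.update_eq_self] at h1
      simpa only [FormalMultilinearSeries.apply_eq_pow_smul_coeff] using h1
    refine PolyApproxOn.of_forall fun ε hε => ?_
    have hlim : Tendsto (fun n => M * (r / r') ^ n / (1 - r / r')) atTop (𝓝 0) := by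
      have := ((tendsto_pow_atTop_nhds_zero_of_lt_one hq0 hq).const_mul M).div_const (1 - r / r')
      simpa using this
    obtain ⟨n, hn⟩ := (hlim.eventually_lt_const hε).exists
    refine ⟨fun z => ∑ m ∈ Finset.range n, z j ^ m • c m z, ?_, fun z hz => ?_⟩
    · refine PolyApproxOn.sum _ fun m _ => ?_
      simpa using (hcA m).polynomial_smul isBounded_closedBall (MvPolynomial.X j ^ m)
    · rw [norm_sub_rev]
      exact (norm_sub_le_of_geometric_bound_of_hasSum hq (hb z hz) (hsum z hz) n).trans hn.le

/-- Every function holomorphic near `Y ∩ realBox a b` is a uniform limit of polynomials on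
`Y ∩ T`. -/
def RungeOn (a b : Fin k × Bool → ℝ) (T Y : Set (Fin k → ℂ)) : Prop :=
  ∀ (E : Type) [NormedAddCommGroup E] [NormedSpace ℂ E] [CompleteSpace E] (g : (Fin k → ℂ) → E),
    HolNear (Y ∩ realBox a b) g → PolyApproxOn (Y ∩ T) g

theorem rungeOn_univ {L r : ℝ} (hr : 0 < r) (hrL : r < L) :
    RungeOn (k := k) (fun _ => -L) (fun _ => L) (closedBall 0 r) univ := by
  intro E _ _ _ g hg
  rw [univ_inter] at hg ⊢
  obtain ⟨O, hO, hbO, hgO⟩ := hg.exists_isOpen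
  refine polyApproxOn_closedBall hr hrL Finset.univ (hgO.mono (subset_trans ?_ hbO))
    fun z _ w _ h => congrArg g (funext fun l => h l (Finset.mem_univ l))
  rintro z hz ⟨j, β⟩
  have h1 : ‖z j‖ < L := (norm_le_pi_norm z j).trans_lt (mem_ball_zero_iff.mp hz)
  have h2 := (Complex.abs_re_le_norm (z j)).trans h1.le
  have h3 := (Complex.abs_im_le_norm (z j)).trans h1.le
  cases β
  · exact abs_le.mp h3
  · exact abs_le.mp h2

theorem polyApproxOn_seqEval [CompleteSpace E] {S : Set (Fin k → ℂ)} (hS : Bornology.IsBounded S)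
    (q : MvPolynomial (Fin k) ℂ) {ρ : ℝ} (hρ : 1 < ρ)
    (hq : ∀ z ∈ S, ‖MvPolynomial.eval z q‖ ≤ 1) {P : (Fin k → ℂ) → (ℕ →ᵇ E)}
    (hP : P ∈ polyMaps k (ℕ →ᵇ E)) :
    PolyApproxOn S (fun z => seqEval (MvPolynomial.eval z q / ρ) (P z)) := by
  have hρ0 : 0 < ρ := by linarith
  have hr : ρ⁻¹ < 1 := inv_lt_one_of_one_lt₀ hρ
  have hw : ∀ z ∈ S, ‖MvPolynomial.eval z q / ρ‖ ≤ ρ⁻¹ := fun z hz => by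
    rw [norm_div, Complex.norm_real, Real.norm_eq_abs, abs_of_pos hρ0, div_eq_mul_inv]
    exact mul_le_of_le_one_left (by positivity) (hq z hz)
  induction hP using Submodule.span_induction with
  | mem h hh =>
    obtain ⟨p, a, rfl⟩ := hh
    simp only [map_smul]
    refine PolyApproxOn.polynomial_smul hS ?_ p
    refine PolyApproxOn.of_forall fun ε hε => ?_
    have hlim : Tendsto (fun n => ‖a‖ * ρ⁻¹ ^ n / (1 - ρ⁻¹)) atTop (𝓝 0) := by
      have := ((tendsto_pow_atTop_nhds_zero_of_lt_one (inv_nonneg.mpr hρ0.le) hr).const_mul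
        ‖a‖).div_const (1 - ρ⁻¹)
      simpa using this
    obtain ⟨n, hn⟩ := (hlim.eventually_lt_const hε).exists
    refine ⟨fun z => ∑ m ∈ Finset.range n, (MvPolynomial.eval z q / ρ) ^ m • a m, ?_,
      fun z hz => (norm_seqEval_sub_sum_le hr (hw z hz) a n).trans hn.le⟩
    refine PolyApproxOn.sum _ fun m _ => PolyApproxOn.of_mem ?_
    convert smul_mem_polyMaps ((q * MvPolynomial.C (ρ : ℂ)⁻¹) ^ m) (a m) using 2 with z
    simp [div_eq_mul_inv]
  | zero => simpa using! PolyApproxOn.of_mem (polyMaps k E).zero_mem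
  | add x y _ _ hx hy => simpa using! hx.add hy
  | smul c x _ hx =>
    simpa using! hx.polynomial_smul hS (MvPolynomial.C c)

theorem differentiable_mvPolynomial_eval (q : MvPolynomial (Fin k) ℂ) :
    Differentiable ℂ fun z : Fin k → ℂ => MvPolynomial.eval z q := by
  induction q using MvPolynomial.induction_on with
  | C c => simp
  | add p q hp hq => simpa using hp.fun_add hq
  | mul_X p j hp => simpa using hp.fun_mul (differentiable_apply j)

theorem RungeOn.inter_norm_le {a b : Fin k × Bool → ℝ} {T Y : Set (Fin k → ℂ)}
    (hR : RungeOn a b T Y) (hT : T ⊆ realBox a b) (hS : SplitsOn Y) (hY : IsClosed Y)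
    (q : MvPolynomial (Fin k) ℂ) : RungeOn a b T (Y ∩ {z | ‖MvPolynomial.eval z q‖ ≤ 1}) := by
  intro E _ _ _ g hg
  have hTb : Bornology.IsBounded T := (isCompact_realBox a b).isBounded.subset hT
  obtain ⟨ρ, hρ, G, hG, hgG⟩ := hS.exists_extension hY (differentiable_mvPolynomial_eval q) a b hg
  have hρ0 : 0 < ρ := by linarith
  have hr : ρ⁻¹ < 1 := inv_lt_one_of_one_lt₀ hρ
  refine PolyApproxOn.of_forall fun ε hε => ?_
  obtain ⟨P, hP, hPG⟩ := hR _ G hG (ε * (1 - ρ⁻¹)) (mul_pos hε (by linarith))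
  refine ⟨_, polyApproxOn_seqEval (hTb.subset inter_subset_right) q hρ (fun z hz => hz.1.2) hP,
    fun z hz => ?_⟩
  have h1 : g z = seqEval (MvPolynomial.eval z q / ρ) (G z) :=
    hgG.self_of_nhdsSet z ⟨hz.1, hT hz.2⟩
  have hw : ‖MvPolynomial.eval z q / ρ‖ ≤ ρ⁻¹ := by
    rw [norm_div, Complex.norm_real, Real.norm_eq_abs, abs_of_pos hρ0, div_eq_mul_inv]
    exact mul_le_of_le_one_left (by positivity) hz.1.2
  rw [h1, ← map_sub]
  refine (norm_seqEval_le hr hw _).trans ?_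
  rw [div_le_iff₀ (by linarith)]
  exact hPG z ⟨hz.1.1, hz.2⟩

end Approximation

section PolynomialHull

variable {k : ℕ}

theorem isClosed_polyHull (C : Set (Fin k → ℂ)) : IsClosed (polyHull C) := by
  have : polyHull C = ⋂ p : MvPolynomial (Fin k) ℂ, {z | ‖MvPolynomial.eval z p‖ ≤
      sSup ((fun ζ => ‖MvPolynomial.eval ζ p‖) '' C)} := by
    ext z; simp [polyHull]
  rw [this]
  exact isClosed_iInter fun p =>
    isClosed_le (MvPolynomial.continuous_eval p).norm continuous_const

theorem bddAbove_norm_image {C : Set (Fin k → ℂ)} (hC : IsCompact C) {g : (Fin k → ℂ) → ℂ}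
    (hg : ContinuousOn g C) : BddAbove ((fun ζ => ‖g ζ‖) '' C) :=
  (hC.image_of_continuousOn hg.norm).bddAbove

theorem subset_polyHull {C : Set (Fin k → ℂ)} (hC : IsCompact C) : C ⊆ polyHull C :=
  fun _ hz p => le_csSup
    (bddAbove_norm_image hC (MvPolynomial.continuous_eval p).continuousOn) ⟨_, hz, rfl⟩

theorem polyHull_empty : polyHull (∅ : Set (Fin k → ℂ)) = ∅ := by
  refine eq_empty_iff_forall_notMem.mpr fun z hz => ?_
  have := hz 1
  simp at this
  linarith

/-- The polynomial polyhedron given by a list of polynomials. -/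
def polyhedron (l : List (MvPolynomial (Fin k) ℂ)) : Set (Fin k → ℂ) :=
  {z | ∀ q ∈ l, ‖MvPolynomial.eval z q‖ ≤ 1}

theorem polyhedron_cons (q : MvPolynomial (Fin k) ℂ) (l : List (MvPolynomial (Fin k) ℂ)) :
    polyhedron (q :: l) = polyhedron l ∩ {z | ‖MvPolynomial.eval z q‖ ≤ 1} := by
  ext z
  simp [polyhedron, and_comm]

theorem isClosed_splitsOn_rungeOn_polyhedron {L r : ℝ} (hr : 0 < r) (hrL : r < L)
    (l : List (MvPolynomial (Fin k) ℂ)) :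
    IsClosed (polyhedron l) ∧ SplitsOn (polyhedron l) ∧
      RungeOn (fun _ => -L) (fun _ => L) (closedBall 0 r) (polyhedron l) := by
  induction l with
  | nil =>
    have : polyhedron ([] : List (MvPolynomial (Fin k) ℂ)) = univ := by simp [polyhedron]
    rw [this]
    exact ⟨isClosed_univ, splitsOn_univ, rungeOn_univ hr hrL⟩
  | cons q l ih =>
    obtain ⟨h1, h2, h3⟩ := ih
    rw [polyhedron_cons]
    refine ⟨h1.inter (isClosed_le (MvPolynomial.continuous_eval q).norm continuous_const),
      h2.inter_norm_le h1 (differentiable_mvPolynomial_eval q), h3.inter_norm_le ?_ h2 h1 q⟩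
    rintro z hz ⟨j, β⟩
    have h1 : ‖z j‖ ≤ L := (norm_le_pi_norm z j).trans ((mem_closedBall_zero_iff.mp hz).trans hrL.le)
    have h2 := (Complex.abs_re_le_norm (z j)).trans h1
    have h3 := (Complex.abs_im_le_norm (z j)).trans h1
    cases β
    · exact abs_le.mp h3
    · exact abs_le.mp h2

theorem exists_polyhedron {C U B : Set (Fin k → ℂ)} (hU : IsOpen U) (hCU : polyHull C ⊆ U)
    (hB : IsCompact B) : ∃ l : List (MvPolynomial (Fin k) ℂ),
      polyHull C ⊆ polyhedron l ∧ polyhedron l ∩ B ⊆ U := by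
  suffices h : ∃ l : List (MvPolynomial (Fin k) ℂ), polyHull C ⊆ polyhedron l ∧
      ∀ z ∈ B \ U, z ∉ polyhedron l by
    obtain ⟨l, h1, h2⟩ := h
    refine ⟨l, h1, fun z hz => ?_⟩
    by_contra hzU
    exact h2 z ⟨hz.2, hzU⟩ hz.1
  refine (hB.diff hU).induction_on (p := fun S => ∃ l : List (MvPolynomial (Fin k) ℂ),
    polyHull C ⊆ polyhedron l ∧ ∀ z ∈ S, z ∉ polyhedron l) ?_ ?_ ?_ ?_
  · exact ⟨[], by simp [polyhedron], by simp⟩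
  · rintro s t hst ⟨l, h1, h2⟩
    exact ⟨l, h1, fun z hz => h2 z (hst hz)⟩
  · rintro s t ⟨l, h1, h2⟩ ⟨l', h1', h2'⟩
    refine ⟨l ++ l', fun z hz q hq => ?_, ?_⟩
    · rcases List.mem_append.mp hq with h | h
      · exact h1 hz q h
      · exact h1' hz q h
    · rintro z (hz | hz) hzl
      · exact h2 z hz fun q hq => hzl q (List.mem_append_left _ hq)
      · exact h2' z hz fun q hq => hzl q (List.mem_append_right _ hq)
  · rintro x ⟨-, hxU⟩
    have hx : x ∉ polyHull C := fun h => hxU (hCU h)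
    simp only [polyHull, mem_ofPred_eq, not_forall, not_le] at hx
    obtain ⟨p, hp⟩ := hx
    obtain ⟨m, hm1, hm2⟩ := exists_between hp
    have hm0 : 0 < m := lt_of_le_of_lt (Real.sSup_nonneg (by
      rintro _ ⟨z, -, rfl⟩; exact norm_nonneg _)) hm1
    have he : ∀ z, ‖MvPolynomial.eval z (MvPolynomial.C (m : ℂ)⁻¹ * p)‖ =
        ‖MvPolynomial.eval z p‖ / m := fun z => by
      simp [abs_of_pos hm0, div_eq_inv_mul]
    refine ⟨{z | 1 < ‖MvPolynomial.eval z (MvPolynomial.C (m : ℂ)⁻¹ * p)‖}, ?_,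
      [MvPolynomial.C (m : ℂ)⁻¹ * p], ?_, ?_⟩
    · refine mem_nhdsWithin_of_mem_nhds ((isOpen_lt continuous_const
        (MvPolynomial.continuous_eval _).norm).mem_nhds ?_)
      show 1 < ‖MvPolynomial.eval x (MvPolynomial.C (m : ℂ)⁻¹ * p)‖
      rw [he, lt_div_iff₀ hm0, one_mul]
      exact hm2
    · intro z hz q hq
      rw [List.mem_singleton.mp hq, he, div_le_one hm0]
      exact (hz p).trans hm1.le
    · intro z hz hzl
      exact absurd (hzl _ (List.mem_singleton.mpr rfl)) (not_le.mpr hz)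

/-- **Oka–Weil theorem**: functions holomorphic near a compact polynomial hull are uniform limits of
polynomials there. -/
theorem exists_polynomial_norm_sub_le {C U : Set (Fin k → ℂ)} (hK : IsCompact (polyHull C))
    (hU : IsOpen U) (hCU : polyHull C ⊆ U) {g : (Fin k → ℂ) → ℂ} (hg : DifferentiableOn ℂ g U)
    {ε : ℝ} (hε : 0 < ε) :
    ∃ p : MvPolynomial (Fin k) ℂ, ∀ z ∈ polyHull C, ‖g z - MvPolynomial.eval z p‖ ≤ ε := by
  obtain ⟨r, hr, hKr⟩ := hK.isBounded.exists_pos_norm_le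
  obtain ⟨l, h1, h2⟩ := exists_polyhedron hU hCU (isCompact_realBox (fun _ : Fin k × Bool => -(r + 1))
    (fun _ => r + 1))
  obtain ⟨-, -, hR⟩ := isClosed_splitsOn_rungeOn_polyhedron hr (lt_add_one r) l
  obtain ⟨P, hP, hPg⟩ := hR ℂ g (HolNear.of_isOpen hU h2 hg) ε hε
  obtain ⟨p, hp⟩ := exists_polynomial_of_mem_polyMaps hP
  refine ⟨p, fun z hz => ?_⟩
  rw [← hp]
  exact hPg z ⟨h1 hz, mem_closedBall_zero_iff.mpr (hKr z hz)⟩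

/-- The maximum principle on a polynomial hull. -/
theorem norm_le_sSup_of_mem_polyHull {C U : Set (Fin k → ℂ)} (hC : IsCompact C)
    (hK : IsCompact (polyHull C)) (hU : IsOpen U) (hCU : polyHull C ⊆ U) {g : (Fin k → ℂ) → ℂ}
    (hg : DifferentiableOn ℂ g U) {z : Fin k → ℂ} (hz : z ∈ polyHull C) :
    ‖g z‖ ≤ sSup ((fun ζ => ‖g ζ‖) '' C) := by
  rcases C.eq_empty_or_nonempty with rfl | hne
  · rw [polyHull_empty] at hz
    exact hz.elim
  refine le_of_forall_pos_le_add fun ε hε => ?_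
  obtain ⟨p, hp⟩ := exists_polynomial_norm_sub_le hK hU hCU hg (half_pos hε)
  have hsub := subset_polyHull hC
  have hbd := bddAbove_norm_image hC (hg.continuousOn.mono (hsub.trans hCU))
  have h1 : ‖MvPolynomial.eval z p‖ ≤ sSup ((fun ζ => ‖g ζ‖) '' C) + ε / 2 := by
    refine (hz p).trans (csSup_le (hne.image _) ?_)
    rintro _ ⟨ζ, hζ, rfl⟩
    have h2 := le_csSup hbd ⟨ζ, hζ, rfl⟩
    have h3 := norm_sub_norm_le (MvPolynomial.eval ζ p) (g ζ)
    rw [norm_sub_rev] at h3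
    simp only at h2 ⊢
    linarith [hp ζ (hsub hζ)]
  have h3 := norm_sub_norm_le (g z) (MvPolynomial.eval z p)
  linarith [hp z hz]

/-- A holomorphic map near a polynomial hull that preserves the set preserves its hull. -/
theorem mapsTo_polyHull {C U : Set (Fin k → ℂ)} (hC : IsCompact C)
    (hK : IsCompact (polyHull C)) (hU : IsOpen U) (hCU : polyHull C ⊆ U)
    {f : (Fin k → ℂ) → (Fin k → ℂ)} (hf : DifferentiableOn ℂ f U) (hfC : MapsTo f C C) :
    MapsTo f (polyHull C) (polyHull C) := by
  intro z hz p
  rcases C.eq_empty_or_nonempty with rfl | hne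
  · rw [polyHull_empty] at hz
    exact hz.elim
  refine (norm_le_sSup_of_mem_polyHull hC hK hU hCU (g := fun z => MvPolynomial.eval (f z) p)
    ((differentiable_mvPolynomial_eval p).comp_differentiableOn hf) hz).trans ?_
  refine csSup_le (hne.image _) ?_
  rintro _ ⟨ζ, hζ, rfl⟩
  exact le_csSup (bddAbove_norm_image hC (MvPolynomial.continuous_eval p).continuousOn)
    ⟨f ζ, hfC hζ, rfl⟩

end PolynomialHull

section Dynamics

variable {k : ℕ} {K U : Set (Fin k → ℂ)} {f : (Fin k → ℂ) → (Fin k → ℂ)}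

theorem differentiableAt_iterate (hU : IsOpen U) (hKU : K ⊆ U) (hf : DifferentiableOn ℂ f U)
    (hfK : MapsTo f K K) (n : ℕ) {z : Fin k → ℂ} (hz : z ∈ K) : DifferentiableAt ℂ f^[n] z := by
  induction n with
  | zero => exact differentiableAt_id
  | succ n ih =>
    rw [Function.iterate_succ']
    exact (hf.differentiableAt (hU.mem_nhds (hKU (hfK.iterate n hz)))).comp z ih

/-- Iterates of a self-map of a bounded set are uniformly Lipschitz at interior points. -/
theorem exists_dist_iterate_le (hK : IsCompact K) (hU : IsOpen U) (hKU : K ⊆ U)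
    (hf : DifferentiableOn ℂ f U) (hfK : MapsTo f K K) :
    ∃ M : ℝ, 0 < M ∧ ∀ x R, ball x R ⊆ interior K → ∀ y ∈ ball x R, ∀ n : ℕ,
      dist (f^[n] y) (f^[n] x) ≤ 2 * M / R * dist y x := by
  obtain ⟨M, hM, hb⟩ := hK.isBounded.exists_pos_norm_le
  refine ⟨M, hM, fun x R hR y hy n => dist_le_of_norm_le_on_ball ?_ (fun z hz => ?_) hy⟩
  · exact fun z hz => (differentiableAt_iterate hU hKU hf hfK n
      (interior_subset (hR hz))).differentiableWithinAt
  · exact hb _ (hfK.iterate n (interior_subset (hR hz)))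

theorem exists_ball_dist_iterate_lt (hK : IsCompact K) (hU : IsOpen U) (hKU : K ⊆ U)
    (hf : DifferentiableOn ℂ f U) (hfK : MapsTo f K K) {x : Fin k → ℂ} (hx : x ∈ interior K)
    {ε : ℝ} (hε : 0 < ε) :
    ∃ δ > 0, ∀ y ∈ ball x δ, ∀ n : ℕ, dist (f^[n] y) (f^[n] x) < ε := by
  obtain ⟨M, hM, h⟩ := exists_dist_iterate_le hK hU hKU hf hfK
  obtain ⟨R, hR, hRV⟩ := Metric.isOpen_iff.mp isOpen_interior x hx
  refine ⟨min R (ε * R / (2 * M)), by positivity, fun y hy n => ?_⟩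
  rw [mem_ball, lt_min_iff] at hy
  refine (h x R hRV y hy.1 n).trans_lt ?_
  have := hy.2
  rw [lt_div_iff₀ (by positivity)] at this
  rw [div_mul_eq_mul_div, div_lt_iff₀ hR]
  linarith

/-- Montel's theorem for the iterates. -/
theorem iteratesNormalOn_interior (hK : IsCompact K) (hU : IsOpen U) (hKU : K ⊆ U)
    (hf : DifferentiableOn ℂ f U) (hfK : MapsTo f K K) : IteratesNormalOn f (interior K) := by
  classical
  intro u
  obtain ⟨M, hM, hlip⟩ := exists_dist_iterate_le hK hU hKU hf hfK
  set V := interior K with hV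
  have hVo : IsOpen V := isOpen_interior
  set A : Set (V → (Fin k → ℂ)) := {φ | (∀ x, φ x ∈ K) ∧ ∀ (x : V) (R : ℝ), ball (x : Fin k → ℂ) R ⊆ V →
    ∀ y : V, (y : Fin k → ℂ) ∈ ball (x : Fin k → ℂ) R →
      dist (φ y) (φ x) ≤ 2 * M / R * dist (y : Fin k → ℂ) x} with hA
  have hsmall : ∀ (x : V) (ε : ℝ), 0 < ε → ∀ᶠ y in 𝓝 x, ∀ φ ∈ A, dist (φ x) (φ y) < ε := by
    intro x ε hε
    obtain ⟨R, hR, hRV⟩ := Metric.isOpen_iff.mp hVo x x.2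
    have hδ : 0 < min R (ε * R / (2 * M)) := by positivity
    filter_upwards [ball_mem_nhds x hδ] with y hy φ hφ
    rw [mem_ball, lt_min_iff, Subtype.dist_eq] at hy
    rw [dist_comm]
    refine (hφ.2 x R hRV y hy.1).trans_lt ?_
    have := hy.2
    rw [lt_div_iff₀ (by positivity)] at this
    rw [div_mul_eq_mul_div, div_lt_iff₀ hR]
    linarith
  have hcont : ∀ φ ∈ A, Continuous φ := fun φ hφ => by
    rw [continuous_iff_continuousAt]
    intro x
    rw [Metric.continuousAt_iff']
    intro ε hε
    filter_upwards [hsmall x ε hε] with y hy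
    rw [dist_comm]
    exact hy φ hφ
  have hAc : IsCompact A := by
    refine (isCompact_univ_pi fun _ : V => hK).of_isClosed_subset ?_ fun φ hφ x _ => hφ.1 x
    have : A = (⋂ x, {φ | φ x ∈ K}) ∩ ⋂ (x : V) (R : ℝ) (_ : ball (x : Fin k → ℂ) R ⊆ V) (y : V)
        (_ : (y : Fin k → ℂ) ∈ ball (x : Fin k → ℂ) R),
        {φ : V → (Fin k → ℂ) | dist (φ y) (φ x) ≤ 2 * M / R * dist (y : Fin k → ℂ) x} := by
      ext φ; simp only [hA, mem_ofPred_eq, mem_inter_iff, mem_iInter]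
    rw [this]
    refine (isClosed_iInter fun x => hK.isClosed.preimage (continuous_apply x)).inter ?_
    refine isClosed_iInter fun x => isClosed_iInter fun R => isClosed_iInter fun _ =>
      isClosed_iInter fun y => isClosed_iInter fun _ => ?_
    exact isClosed_le ((continuous_apply y).dist (continuous_apply x)) continuous_const
  set S : Set C(V, Fin k → ℂ) := {F | (F : V → (Fin k → ℂ)) ∈ A} with hS
  have hSc : IsCompact S := by
    refine ArzelaAscoli.isCompact_of_equicontinuous S ?_ ?_
    · convert hAc
      ext φ
      constructor
      · rintro ⟨F, hF, rfl⟩; exact hF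
      · intro hφ; exact ⟨⟨φ, hcont φ hφ⟩, hφ, rfl⟩
    · intro x
      rw [Metric.equicontinuousAt_iff_right]
      intro ε hε
      filter_upwards [hsmall x ε hε] with y hy F
      exact hy _ F.2
  have hFmem : ∀ n, (fun x : V => f^[u n] x) ∈ A := fun n =>
    ⟨fun x => hfK.iterate _ (interior_subset x.2), fun x R hR y hy => hlip x R hR y hy _⟩
  have : LocallyCompactSpace V := hVo.locallyCompactSpace
  obtain ⟨F, -, φ, hφ, hlim⟩ := hSc.tendsto_subseq (x := fun n => ⟨_, hcont _ (hFmem n)⟩) hFmem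
  refine ⟨φ, hφ, fun z => if hz : z ∈ V then F ⟨z, hz⟩ else 0, ?_⟩
  rw [tendstoLocallyUniformlyOn_iff_tendstoLocallyUniformly_comp_coe]
  rw [ContinuousMap.tendsto_iff_tendstoLocallyUniformly] at hlim
  have e : (fun z => if hz : z ∈ V then F ⟨z, hz⟩ else 0) ∘ (Subtype.val : V → Fin k → ℂ) = F := by
    funext x
    simp
  rw [e]
  exact hlim

theorem StrictMono.add_le_apply_add {n : ℕ → ℕ} (hn : StrictMono n) (i j : ℕ) :
    n i + j ≤ n (i + j) := by
  induction j with
  | zero => simp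
  | succ j ih =>
    have := hn (Nat.lt_succ_self (i + j))
    have : n (i + j) < n (i + (j + 1)) := this
    omega

theorem iterate_tendsto_of_tendsto (hK : IsCompact K) (hU : IsOpen U) (hKU : K ⊆ U)
    (hf : DifferentiableOn ℂ f U) (hfK : MapsTo f K K) {x : Fin k → ℂ} (hx : x ∈ interior K)
    {y : ℕ → Fin k → ℂ} (hy : Tendsto y atTop (𝓝 x)) (m : ℕ → ℕ) {c : Fin k → ℂ} :
    Tendsto (fun i => f^[m i] (y i)) atTop (𝓝 c) ↔ Tendsto (fun i => f^[m i] x) atTop (𝓝 c) := by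
  have h : Tendsto (fun i => dist (f^[m i] (y i)) (f^[m i] x)) atTop (𝓝 0) := by
    rw [Metric.tendsto_atTop]
    intro ε hε
    obtain ⟨δ, hδ, h⟩ := exists_ball_dist_iterate_lt hK hU hKU hf hfK hx hε
    obtain ⟨N, hN⟩ := Metric.tendsto_atTop.mp hy δ hδ
    refine ⟨N, fun n hn => ?_⟩
    simpa using h _ (hN n hn) (m n)
  exact tendsto_iff_of_dist h

/-- A limit of iterates of full rank produces a component on which iterates tend to the identity. -/
theorem exists_component_tendsto_id (hK : IsCompact K) (hU : IsOpen U) (hKU : K ⊆ U)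
    (hf : DifferentiableOn ℂ f U) (hfK : MapsTo f K K) {D : Set (Fin k → ℂ)} (hD : IsOpen D)
    (hDK : D ⊆ interior K) {h : (Fin k → ℂ) → (Fin k → ℂ)} (hh : IsIterateLimitOn f D h)
    {z : Fin k → ℂ} (hz : z ∈ D) (hr : (fderiv ℂ h z).range = ⊤) :
    ∃ S, IsComponentOf S (interior K) ∧ IsIterateLimitOn f S id := by
  obtain ⟨n, hn, hlim⟩ := hh
  have hdn : ∀ n, DifferentiableOn ℂ f^[n] (interior K) := fun n z hz =>
    (differentiableAt_iterate hU hKU hf hfK n (interior_subset hz)).differentiableWithinAt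
  have hhd : DifferentiableOn ℂ h D := fun x hx =>
    (hasFDerivAt_and_tendsto_fderiv_of_holomorphic hD (fun i => (hdn (n i)).mono hDK)
      hlim hx).1.differentiableWithinAt
  have hhK : MapsTo h D K := fun x hx => hK.isClosed.mem_of_tendsto (hlim.tendsto_at hx)
    (Eventually.of_forall fun i => hfK.iterate _ (interior_subset (hDK hx)))
  have hmap : map h (𝓝 z) = 𝓝 (h z) :=
    (hasStrictFDerivAt_of_holomorphic hhd hD hz).map_nhds_eq_of_surj hr
  have himg : h '' D ∈ 𝓝 (h z) := hmap ▸ image_mem_map (hD.mem_nhds hz)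
  have hw : h z ∈ interior K :=
    mem_interior_iff_mem_nhds.mpr (Filter.mem_of_superset himg hhK.image_subset)
  obtain ⟨φ, hφ, g, hg⟩ := iteratesNormalOn_interior hK hU hKU hf hfK
    (fun i => n (i + i) - n i)
  have hm : ∀ i, i ≤ n (i + i) - n i := fun i => by
    have := hn.add_le_apply_add i i
    omega
  have hgid : ∀ y ∈ h '' D ∩ interior K, g y = y := by
    rintro _ ⟨⟨x, hx, rfl⟩, hy⟩
    have h1 : Tendsto (fun i => f^[n (φ i)] x) atTop (𝓝 (h x)) :=
      (hlim.tendsto_at hx).comp hφ.tendsto_atTop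
    have h2 := (iterate_tendsto_of_tendsto hK hU hKU hf hfK hy h1
      (fun i => n (φ i + φ i) - n (φ i))).mpr (hg.tendsto_at hy)
    have h3 : ∀ i, f^[n (φ i + φ i) - n (φ i)] (f^[n (φ i)] x) = f^[n (φ i + φ i)] x := fun i => by
      rw [← Function.iterate_add_apply, Nat.sub_add_cancel (hn.monotone (by omega))]
    simp only [h3] at h2
    refine tendsto_nhds_unique h2 ((hlim.tendsto_at hx).comp ?_)
    exact tendsto_atTop_mono (fun i => (by omega : φ i ≤ φ i + φ i)) hφ.tendsto_atTop
  set S := connectedComponentIn (interior K) (h z) with hS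
  have hSK : S ⊆ interior K := connectedComponentIn_subset _ _
  have hgd : DifferentiableOn ℂ g (interior K) := fun x hx =>
    (hasFDerivAt_and_tendsto_fderiv_of_holomorphic isOpen_interior (fun i => hdn _)
      hg hx).1.differentiableWithinAt
  have hgS : ∀ y ∈ S, g y - y = 0 := by
    refine eqOn_zero_of_holomorphic ((hgd.mono hSK).sub differentiableOn_id)
      isOpen_interior.connectedComponentIn isPreconnected_connectedComponentIn
      (mem_connectedComponentIn hw) ?_
    filter_upwards [himg, isOpen_interior.mem_nhds hw] with y hy hy'
    simp [hgid y ⟨hy, hy'⟩]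
  have htop : Tendsto (fun i => n (φ i + φ i) - n (φ i)) atTop atTop :=
    tendsto_atTop_mono (fun i => (hφ.le_apply (x := i)).trans (hm (φ i))) tendsto_id
  obtain ⟨ψ, hψ, hmono⟩ := strictMono_subseq_of_tendsto_atTop htop
  refine ⟨S, ⟨h z, hw, rfl⟩, _, hmono, ?_⟩
  have h4 : TendstoLocallyUniformlyOn (fun i => f^[n (φ i + φ i) - n (φ i)]) id atTop S :=
    (hg.mono hSK).congr_right fun y hy => sub_eq_zero.mp (hgS y hy)
  intro s hs x hx
  obtain ⟨t, ht, h5⟩ := h4 s hs x hx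
  exact ⟨t, ht, hψ.tendsto_atTop.eventually h5⟩

/-- A recurrent component contains a recurrent point. -/
theorem exists_recurrent_point (hK : IsCompact K) (hU : IsOpen U) (hKU : K ⊆ U)
    (hf : DifferentiableOn ℂ f U) (hfK : MapsTo f K K) {W : Set (Fin k → ℂ)}
    (hWK : W ⊆ interior K) (hW : IsRecurrentFor f W) :
    ∃ q ∈ W, ∀ N : ℕ, ∀ ε > 0, ∃ n ≥ N, dist (f^[n] q) q < ε := by
  obtain ⟨p, -, n, hn, hc, hcW⟩ := hW
  obtain ⟨q, hq, φ, hφ, hlim⟩ := hc.tendsto_subseq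
    (x := fun i => f^[n i] p) fun i => subset_closure ⟨i, rfl⟩
  refine ⟨q, hcW hq, fun N ε hε => ?_⟩
  obtain ⟨δ, hδ, hδq⟩ := exists_ball_dist_iterate_lt hK hU hKU hf hfK (hWK (hcW hq)) (half_pos hε)
  obtain ⟨i, hi⟩ := Metric.tendsto_atTop.mp hlim (min δ (ε / 2)) (by positivity)
  have hmono : StrictMono fun i => n (φ i) := hn.comp hφ
  have h1 := hi i le_rfl
  have h2 := hi (i + N) (by omega)
  have h3 := hmono.add_le_apply_add i N
  simp only [Function.comp_apply, lt_min_iff] at h1 h2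
  refine ⟨n (φ (i + N)) - n (φ i), by omega, ?_⟩
  have h4 := hδq _ h1.1 (n (φ (i + N)) - n (φ i))
  rw [← Function.iterate_add_apply, Nat.sub_add_cancel (by omega)] at h4
  have := dist_triangle_left (f^[n (φ (i + N)) - n (φ i)] q) q (f^[n (φ (i + N))] p)
  linarith [h2.2]

/-- If iterates converge to a constant along a sequence on a domain with a recurrent point, then the
constant is periodic and its orbit meets the domain. -/
theorem exists_periodic_of_tendsto_const (hK : IsCompact K) (hU : IsOpen U) (hKU : K ⊆ U)
    (hf : DifferentiableOn ℂ f U) (hfK : MapsTo f K K) {W : Set (Fin k → ℂ)} (hWo : IsOpen W)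
    (hWK : W ⊆ interior K) {q : Fin k → ℂ} (hq : q ∈ W)
    (hrec : ∀ N : ℕ, ∀ ε > 0, ∃ n ≥ N, dist (f^[n] q) q < ε) {m : ℕ → ℕ} {c : Fin k → ℂ}
    (hm : ∀ z ∈ W, Tendsto (fun j => f^[m j] z) atTop (𝓝 c)) :
    (∃ n > 0, f^[n] c = c) ∧ ∃ l, f^[l] c ∈ W := by
  have hWK' : W ⊆ K := hWK.trans interior_subset
  have hcK : c ∈ K := hK.isClosed.mem_of_tendsto (hm q hq)
    (Eventually.of_forall fun j => hfK.iterate _ (hWK' hq))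
  have hcont : ∀ n, ∀ x ∈ K, ContinuousAt f^[n] x := fun n x hx =>
    (differentiableAt_iterate hU hKU hf hfK n hx).continuousAt
  have hper : ∃ n > 0, f^[n] c = c := by
    obtain ⟨ε, hε, hεW⟩ := Metric.isOpen_iff.mp hWo q hq
    obtain ⟨n, hn, hnq⟩ := hrec 1 ε hε
    refine ⟨n, hn, tendsto_nhds_unique ((hcont n c hcK).tendsto.comp (hm q hq)) ?_⟩
    have h1 := hm _ (hεW (mem_ball.mpr hnq))
    refine h1.congr fun j => ?_
    rw [Function.comp_apply, ← Function.iterate_add_apply, ← Function.iterate_add_apply, add_comm]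
  refine ⟨hper, ?_⟩
  obtain ⟨n₀, hn₀, hc⟩ := hper
  obtain ⟨R, hR, hRW⟩ := Metric.isOpen_iff.mp hWo q hq
  set r := R / 2 with hr
  have hr0 : 0 < r := by positivity
  have hcb : closedBall q r ⊆ W := (closedBall_subset_ball (by linarith)).trans hRW
  classical
  set t : ℕ → ℕ := fun j => Nat.findGreatest (fun t => dist (f^[t] q) q < r) (m j) with ht
  have htm : ∀ j, t j ≤ m j := fun j => Nat.findGreatest_le _
  have htr : ∀ j, dist (f^[t j] q) q < r := fun j =>
    Nat.findGreatest_spec (P := fun t => dist (f^[t] q) q < r) (Nat.zero_le (m j))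
      (by simpa using hr0)
  obtain ⟨y, hy, φ, hφ, hlim⟩ := (isCompact_closedBall q r).tendsto_subseq
    (x := fun j => f^[t j] q) fun j => mem_closedBall.mpr (htr j).le
  have hyW := hcb hy
  -- the waiting times since the last visit are bounded
  obtain ⟨B, hB⟩ : ∃ B, ∀ᶠ j in atTop, m (φ j) - t (φ j) < B := by
    obtain ⟨δ, hδ, hδy⟩ := exists_ball_dist_iterate_lt hK hU hKU hf hfK (hWK hyW)
      (show 0 < r / 4 by positivity)
    obtain ⟨j₀, hj₀⟩ := Metric.tendsto_atTop.mp hlim δ hδ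
    obtain ⟨n, hn, hnq⟩ := hrec (t (φ j₀) + 1) (r / 2) (by positivity)
    refine ⟨n - t (φ j₀), eventually_atTop.mpr ⟨j₀, fun j hj => ?_⟩⟩
    by_contra! hle
    have h1 := hδy _ (hj₀ j hj) (n - t (φ j₀))
    have h2 := hδy _ (hj₀ j₀ le_rfl) (n - t (φ j₀))
    simp only [Function.comp_apply] at h1 h2
    rw [← Function.iterate_add_apply] at h1 h2
    rw [Nat.sub_add_cancel (by omega)] at h2
    have h3 : dist (f^[n - t (φ j₀) + t (φ j)] q) q < r := by
      have e1 := dist_triangle (f^[n - t (φ j₀) + t (φ j)] q) (f^[n - t (φ j₀)] y) q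
      have e2 := dist_triangle_left (f^[n - t (φ j₀)] y) q (f^[n] q)
      linarith
    have h4 := Nat.le_findGreatest (P := fun t => dist (f^[t] q) q < r)
      (show n - t (φ j₀) + t (φ j) ≤ m (φ j) by have := htm (φ j); omega) h3
    change _ ≤ t (φ j) at h4
    omega
  obtain ⟨s, hs⟩ : ∃ s, ∃ᶠ j in atTop, m (φ j) - t (φ j) = s := by
    by_contra! hne
    have h1 : ∀ᶠ j in atTop, ∀ s ∈ Finset.range B, m (φ j) - t (φ j) ≠ s :=
      (Finset.eventually_all _).mpr fun s _ => hne s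
    obtain ⟨j, hj1, hj2⟩ := (h1.and hB).exists
    exact hj1 _ (Finset.mem_range.mpr hj2) rfl
  have hsy : f^[s] y = c := by
    refine tendsto_nhds_unique_of_frequently_eq
      ((hcont s y (hWK' hyW)).tendsto.comp hlim) ((hm q hq).comp hφ.tendsto_atTop) ?_
    refine hs.mono fun j hj => ?_
    simp only [Function.comp_apply]
    rw [← Function.iterate_add_apply, ← hj, Nat.sub_add_cancel (htm _)]
  -- `y` is recurrent
  have hyrec : ∀ ε > 0, ∃ n ≥ s, dist (f^[n] y) y < ε := by
    intro ε hε
    obtain ⟨δ₁, hδ₁, h1⟩ := exists_ball_dist_iterate_lt hK hU hKU hf hfK (hWK hyW)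
      (show 0 < ε / 3 by positivity)
    obtain ⟨δ₂, hδ₂, h2⟩ := exists_ball_dist_iterate_lt hK hU hKU hf hfK (hWK hq)
      (show 0 < ε / 3 by positivity)
    obtain ⟨j, hj⟩ := Metric.tendsto_atTop.mp hlim (min δ₁ (ε / 3)) (by positivity)
    have h3 := hj j le_rfl
    rw [lt_min_iff] at h3
    obtain ⟨n, hn, hnq⟩ := hrec s δ₂ hδ₂
    refine ⟨n, hn, ?_⟩
    have e1 := h1 _ h3.1 n
    have e2 := h2 _ (mem_ball.mpr hnq) (t (φ j))
    simp only [Function.comp_apply] at e1 h3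
    rw [← Function.iterate_add_apply, add_comm, Function.iterate_add_apply] at e2
    have d1 := dist_triangle_left (f^[n] y) y (f^[n] (f^[t (φ j)] q))
    have d2 := dist_triangle (f^[n] (f^[t (φ j)] q)) (f^[t (φ j)] q) y
    linarith [h3.2]
  have horb : y ∈ (fun l => f^[l] c) '' (Finset.range n₀ : Set ℕ) := by
    rw [← (((Finset.range n₀).finite_toSet.image _).isClosed).closure_eq, Metric.mem_closure_iff]
    intro ε hε
    obtain ⟨n, hn, hny⟩ := hyrec ε hε
    refine ⟨f^[n] y, ⟨(n - s) % n₀, by simpa using Nat.mod_lt _ hn₀, ?_⟩, by rwa [dist_comm]⟩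
    have hp : Function.IsPeriodicPt f n₀ c := hc
    simp only
    rw [hp.iterate_mod_apply, ← hsy, ← Function.iterate_add_apply, Nat.sub_add_cancel hn]
  obtain ⟨l, -, hl⟩ := horb
  exact ⟨l, by simp only at hl; rwa [hl]⟩

/-- A constant limit of iterates on a recurrent domain produces an attracting periodic orbit. -/
theorem hasAttractingPeriodicOrbit_of_tendsto_const (hK : IsCompact K) (hU : IsOpen U)
    (hKU : K ⊆ U) (hf : DifferentiableOn ℂ f U) (hfK : MapsTo f K K) {W : Set (Fin k → ℂ)}
    (hWo : IsOpen W) (hWK : W ⊆ interior K) (hW : IsRecurrentFor f W) {m : ℕ → ℕ}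
    (hmono : StrictMono m) {c : Fin k → ℂ}
    (hm : TendstoLocallyUniformlyOn (fun j => f^[m j]) (fun _ => c) atTop W) :
    HasAttractingPeriodicOrbit f U := by
  have hWK' : W ⊆ K := hWK.trans interior_subset
  obtain ⟨q, hq, hrec⟩ := exists_recurrent_point hK hU hKU hf hfK hWK hW
  obtain ⟨⟨n₀, hn₀, hc⟩, l, hl⟩ := exists_periodic_of_tendsto_const hK hU hKU hf hfK hWo hWK hq
    hrec fun z hz => hm.tendsto_at hz
  set y := f^[l] c with hy
  have hcK : c ∈ K := hK.isClosed.mem_of_tendsto (hm.tendsto_at hq)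
    (Eventually.of_forall fun j => hfK.iterate _ (hWK' hq))
  have hp : Function.IsPeriodicPt f n₀ c := hc
  have hev : ∀ᶠ j in atTop, f^[m j] y = c := by
    set O : Set (Fin k → ℂ) := (fun l => f^[l] c) '' (Finset.range n₀ : Set ℕ) with hO
    have hOf : (O \ {c}).Finite := ((Finset.range n₀).finite_toSet.image _).sdiff
    have hnhds : (O \ {c})ᶜ ∈ 𝓝 c := hOf.isClosed.isOpen_compl.mem_nhds (by simp)
    filter_upwards [(hm.tendsto_at hl).eventually hnhds] with j hj
    by_contra hne
    refine hj ⟨⟨(m j + l) % n₀, by simpa using Nat.mod_lt _ hn₀, ?_⟩, hne⟩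
    simp only
    rw [hp.iterate_mod_apply, hy, ← Function.iterate_add_apply]
  have hder := (hasFDerivAt_and_tendsto_fderiv_of_holomorphic hWo (fun j z hz =>
    (differentiableAt_iterate hU hKU hf hfK (m j) (hWK' hz)).differentiableWithinAt) hm hl).2
  have hzero : Tendsto (fun j => ‖fderiv ℂ f^[l] c‖ * ‖fderiv ℂ f^[m j] y‖) atTop (𝓝 0) := by
    have h0 : fderiv ℂ (fun _ : Fin k → ℂ => c) y = 0 := by simp
    rw [h0] at hder
    simpa using hder.norm.const_mul ‖fderiv ℂ f^[l] c‖
  obtain ⟨j, hj1, hj2, hj3⟩ := (hev.and ((hzero.eventually_lt_const one_pos).and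
    (eventually_ge_atTop 1))).exists
  have hmj : 1 ≤ m j := hj3.trans (hmono.le_apply (x := j))
  refine ⟨y, l + m j, by omega, fun i => hKU (hfK.iterate i (hWK' hl)), ?_, fun μ hμ => ?_⟩
  · rw [Function.iterate_add_apply, hj1]
  · have hchain : fderiv ℂ f^[l + m j] y = (fderiv ℂ f^[l] c).comp (fderiv ℂ f^[m j] y) := by
      rw [Function.iterate_add, fderiv_comp, hj1]
      · rw [hj1]; exact differentiableAt_iterate hU hKU hf hfK l hcK
      · exact differentiableAt_iterate hU hKU hf hfK _ (hWK' hl)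
    have hlt : ‖fderiv ℂ f^[l + m j] y‖ < 1 := by
      rw [hchain]
      exact (ContinuousLinearMap.opNorm_comp_le _ _).trans_lt hj2
    obtain ⟨v, hv⟩ := hμ.exists_hasEigenvector
    have hv0 : 0 < ‖v‖ := norm_pos_iff.mpr hv.2
    have h1 : fderiv ℂ f^[l + m j] y v = μ • v := hv.apply_eq_smul
    have h2 := (fderiv ℂ f^[l + m j] y).le_opNorm v
    rw [h1, norm_smul] at h2
    exact (le_of_mul_le_mul_right h2 hv0).trans_lt hlt

theorem bddAbove_finrank_range (h : (Fin k → ℂ) → (Fin k → ℂ)) (D : Set (Fin k → ℂ)) :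
    BddAbove ((fun z => Module.finrank ℂ (LinearMap.range
    ((fderiv ℂ h z : (Fin k → ℂ) →L[ℂ] (Fin k → ℂ)) : (Fin k → ℂ) →ₗ[ℂ] (Fin k → ℂ)))) '' D) := by
  refine ⟨k, ?_⟩
  rintro _ ⟨z, -, rfl⟩
  simpa using Submodule.finrank_le (LinearMap.range
    ((fderiv ℂ h z : (Fin k → ℂ) →L[ℂ] (Fin k → ℂ)) : (Fin k → ℂ) →ₗ[ℂ] (Fin k → ℂ)))

theorem fderiv_eq_zero_of_mapRank_eq_zero {h : (Fin k → ℂ) → (Fin k → ℂ)} {D : Set (Fin k → ℂ)}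
    (h0 : mapRank h D = 0) {z : Fin k → ℂ} (hz : z ∈ D) : fderiv ℂ h z = 0 := by
  have h1 := le_csSup (bddAbove_finrank_range h D) ⟨z, hz, rfl⟩
  have h2 : Module.finrank ℂ (LinearMap.range
    ((fderiv ℂ h z : (Fin k → ℂ) →L[ℂ] (Fin k → ℂ)) : (Fin k → ℂ) →ₗ[ℂ] (Fin k → ℂ))) = 0 :=
    Nat.le_zero.mp (h1.trans h0.le)
  rw [Submodule.finrank_eq_zero, LinearMap.range_eq_bot] at h2
  exact ContinuousLinearMap.coe_injective h2

theorem exists_range_eq_top_of_le_mapRank {h : (Fin k → ℂ) → (Fin k → ℂ)} {D : Set (Fin k → ℂ)}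
    (hD : D.Nonempty) (hk : k ≤ mapRank h D) : ∃ z ∈ D, (fderiv ℂ h z).range = ⊤ := by
  obtain ⟨z, hz, hzr⟩ := Nat.sSup_mem (hD.image _) (bddAbove_finrank_range h D)
  refine ⟨z, hz, Submodule.eq_top_of_finrank_eq (le_antisymm (Submodule.finrank_le _) ?_)⟩
  simpa using hk.trans hzr.ge

end Dynamics

section MainTheorem

variable {k : ℕ} {K U : Set (Fin k → ℂ)} {f : (Fin k → ℂ) → (Fin k → ℂ)}

theorem hasAttractingPeriodicOrbit_of_fderiv_eq_zero (hK : IsCompact K) (hU : IsOpen U)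
    (hKU : K ⊆ U) (hf : DifferentiableOn ℂ f U) (hfK : MapsTo f K K) {W : Set (Fin k → ℂ)}
    (hWo : IsOpen W) (hWc : IsPreconnected W) (hWK : W ⊆ interior K) (hW : IsRecurrentFor f W)
    {h : (Fin k → ℂ) → (Fin k → ℂ)} (hh : IsIterateLimitOn f W h)
    (h0 : ∀ z ∈ W, fderiv ℂ h z = 0) : HasAttractingPeriodicOrbit f U := by
  obtain ⟨m, hm, hlim⟩ := hh
  have hd : DifferentiableOn ℂ h W := fun z hz =>
    (hasFDerivAt_and_tendsto_fderiv_of_holomorphic hWo (fun j z hz =>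
      (differentiableAt_iterate hU hKU hf hfK (m j)
        (interior_subset (hWK hz))).differentiableWithinAt) hlim hz).1.differentiableWithinAt
  obtain ⟨c, hc⟩ := hWo.exists_is_const_of_fderiv_eq_zero hWc hd h0
  exact hasAttractingPeriodicOrbit_of_tendsto_const hK hU hKU hf hfK hWo hWK hW hm
    (hlim.congr_right hc)

end MainTheorem

theorem proposition3p3 {k : ℕ} (U : Set (Fin k → ℂ)) (hUo : IsOpen U) (hUc : IsConnected U)
    (hUp : IsPolyConvex U) (f : (Fin k → ℂ) → (Fin k → ℂ)) (hf : DifferentiableOn ℂ f U)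
    (C : Set (Fin k → ℂ)) (hC : IsClosed C) (hCU : RelCompactIn C U) (hCf : MapsTo f C C)
    (V : Set (Fin k → ℂ)) (hV : V = interior (polyHull C)) (hVne : V.Nonempty) :
    -- all iterates are defined on `V`, and they form a normal family there
    (∀ n : ℕ, MapsTo f^[n] V U) ∧ IteratesNormalOn f V ∧
    ∀ W : Set (Fin k → ℂ), IsComponentOf W V → IsRecurrentFor f W →
      HasAttractingPeriodicOrbit f U ∨
      (∃ S : Set (Fin k → ℂ), IsComponentOf S V ∧ IsIterateLimitOn f S id) ∨
      ((∀ h : (Fin k → ℂ) → (Fin k → ℂ), IsIterateLimitOn f W h →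
          0 < mapRank h W ∧ mapRank h W < k) ∧
        (∀ h : (Fin k → ℂ) → (Fin k → ℂ), IsIterateLimitOn f V h →
          0 < mapRank h V ∧ mapRank h V < k)) := by
  have hCc : IsCompact C := by simpa [hC.closure_eq] using hCU.1
  have hCU' : C ⊆ U := subset_closure.trans hCU.2
  obtain ⟨hKc, hKU⟩ := hUp C hCc hCU'
  rw [(isClosed_polyHull C).closure_eq] at hKc hKU
  have hfK := mapsTo_polyHull hCc hKc hUo hKU hf hCf
  subst hV
  refine ⟨fun n z hz => hKU (hfK.iterate n (interior_subset hz)),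
    iteratesNormalOn_interior hKc hUo hKU hf hfK, ?_⟩
  rintro W ⟨x, hx, rfl⟩ hW
  have hWo : IsOpen (connectedComponentIn (interior (polyHull C)) x) :=
    isOpen_interior.connectedComponentIn
  have hWV := connectedComponentIn_subset (interior (polyHull C)) x
  have hWne : (connectedComponentIn (interior (polyHull C)) x).Nonempty :=
    ⟨x, mem_connectedComponentIn hx⟩
  have hattr := fun h (hh : IsIterateLimitOn f _ h) =>
    hasAttractingPeriodicOrbit_of_fderiv_eq_zero hKc hUo hKU hf hfK hWo
      isPreconnected_connectedComponentIn hWV hW hh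
  refine or_iff_not_imp_left.mpr fun hna => or_iff_not_imp_left.mpr fun hns =>
    ⟨fun h hh => ⟨?_, ?_⟩, fun h hh => ⟨?_, ?_⟩⟩
  · by_contra h0
    exact hna (hattr h hh fun z hz => fderiv_eq_zero_of_mapRank_eq_zero (by omega) hz)
  · by_contra! hk
    obtain ⟨z, hz, hr⟩ := exists_range_eq_top_of_le_mapRank hWne hk
    exact hns (exists_component_tendsto_id hKc hUo hKU hf hfK hWo hWV hh hz hr)
  · by_contra h0
    obtain ⟨n, hn, hlim⟩ := hh
    exact hna (hattr h ⟨n, hn, hlim.mono hWV⟩ fun z hz =>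
      fderiv_eq_zero_of_mapRank_eq_zero (D := interior (polyHull C)) (by omega) (hWV hz))
  · by_contra! hk
    obtain ⟨z, hz, hr⟩ := exists_range_eq_top_of_le_mapRank hVne hk
    exact hns (exists_component_tendsto_id hKc hUo hKU hf hfK isOpen_interior subset_rfl hh hz hr)
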